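/- Let $K$ be an $n$-dimensional metric simplicial complex of bounded geometry: $K$ is non-empty and connected, every simplex of $K$ is a face of an $n$-simplex, there is a uniform bound on the number of edges at a vertex, every edge has length $1$, and every simplex is Euclidean. Let $\pi=\langle p_0,p_1,\dots,p_n\rangle\subset(1,\infty)$ be a non-increasing sequence. Let $S\mathscr L^k_\pi(K)$ be the Banach space obtained as the closure of the space of those $k$-forms $\omega$ on $K$ that are smooth on every (closed) simplex, with restrictions to common faces agreeing, and that have finite norm $$\|\omega\|=\Big(\sum_{T}\sup_T|\omega|^{p_k}\Big)^{1/p_k}+\Big(\sum_{T}\sup_T|d\omega|^{p_{k+1}}\Big)^{1/p_{k+1}},$$ where $T$ runs over the $n$-simplices of $K$ (for $k=n$ the second term is $0$). With the exterior differential $d$ these spaces form a complex $S\mathscr L_\pi(K)$ of Banach spaces and bounded linear maps. Let $\mathscr I$ be the de Rham map, which sends $\omega\in S\mathscr L^k_\pi(K)$ to the simplicial cochain $\sigma\mapsto\int_\sigma\omega$ on the $k$-simplices of $K$, and let $\ker^k_\pi\mathscr I\subset S\mathscr L^k_\pi(K)$ be its kernel in degree $k$. Then $d$ maps $\ker^k_\pi\mathscr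 I$ into $\ker^{k+1}_\pi\mathscr I$, so that $\ker_\pi\mathscr I$ is a subcomplex of $S\mathscr L_\pi(K)$, and this complex is contractible in the category of Banach spaces and bounded linear maps: there are bounded linear maps $h^k\colon\ker^k_\pi\mathscr I\to\ker^{k-1}_\pi\mathscr I$ with $$1=d^{k-1}h^k+h^{k+1}d^k\quad\text{on }\ker^k_\pi\mathscr I\text{ for all }k .$$ Consequently $\ker_\pi\mathscr I$ is homotopy equivalent to the zero complex, $\ker_\pi\mathscr I\cong 0$. -/

import Mathlib

open CategoryTheory
open scoped ENNReal

universe u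

noncomputable section

/-! ### The category of Banach spaces and bounded linear maps -/

/-- A (real) Banach space, as an object of the category of Banach spaces. -/
structure Ban : Type (u + 1) where
  carrier : Type u
  [normedAddCommGroup : NormedAddCommGroup carrier]
  [normedSpace : NormedSpace ℝ carrier]
  [completeSpace : CompleteSpace carrier]

namespace Ban

instance : CoeSort Ban.{u} (Type u) := ⟨Ban.carrier⟩

attribute [instance] Ban.normedAddCommGroup Ban.normedSpace Ban.completeSpace

/-- Morphisms are the bounded (continuous) linear maps. -/
instance : Category Ban.{u} where
  Hom X Y := X →L[ℝ] Y
  id X := ContinuousLinearMap.id ℝ X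
  comp f g := ContinuousLinearMap.comp g f

instance (X Y : Ban.{u}) : AddCommGroup (X ⟶ Y) :=
  inferInstanceAs (AddCommGroup (X.carrier →L[ℝ] Y.carrier))

instance : Preadditive Ban.{u} where
  add_comp _ _ _ f f' g := ContinuousLinearMap.comp_add g f f'
  comp_add _ _ _ f g g' := ContinuousLinearMap.add_comp g g' f

instance : Limits.HasZeroObject Ban.{u} where
  zero := ⟨⟨PUnit.{u + 1}⟩,
    { unique_to := fun X => ⟨⟨⟨0⟩, fun f =>
        ContinuousLinearMap.ext (f := (f : PUnit.{u + 1} →L[ℝ] X.carrier)) (g := 0) fun x => by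
          rw [Subsingleton.elim x 0, map_zero, map_zero]⟩⟩
      unique_from := fun X => ⟨⟨⟨0⟩, fun f =>
        ContinuousLinearMap.ext (f := (f : X.carrier →L[ℝ] PUnit.{u + 1})) (g := 0) fun _ =>
          Subsingleton.elim _ _⟩⟩ }⟩

end Ban

/-! ### Metric simplicial complexes of bounded geometry -/

variable {E : Type u} [NormedAddCommGroup E] [InnerProductSpace ℝ E]

/-- An `n`-dimensional metric simplicial complex of bounded geometry all of whose edges have
length `1`.  The complex is realised with vertices in a real inner product space `E`, so that each
simplex with `m + 1` vertices carries the metric of the regular Euclidean `m`-simplex of edge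
length `1`. -/
structure BoundedGeometryComplex (E : Type u) [NormedAddCommGroup E] [InnerProductSpace ℝ E]
    (n : ℕ) extends Geometry.SimplicialComplex ℝ E where
  /-- The complex is not empty. -/
  faces_nonempty : faces.Nonempty
  /-- The complex is (purely) `n`-dimensional: each simplex is a face of an `n`-simplex. -/
  pure : ∀ s ∈ faces, ∃ t ∈ faces, s ⊆ t ∧ t.card = n + 1
  /-- Every edge has length `1`. -/
  edge_length : ∀ s ∈ faces, ∀ x ∈ s, ∀ y ∈ s, x ≠ y → dist x y = 1
  /-- The complex is connected: any two vertices are joined by a path of edges. -/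
  connected : ∀ x y : E, {x} ∈ faces → {y} ∈ faces →
    Relation.ReflTransGen (fun a b : E => ∃ s ∈ faces, a ∈ s ∧ b ∈ s) x y
  /-- The complex is star-bounded: some `N` bounds the number of edges at each vertex. -/
  star_bounded : ∃ N : ℕ, ∀ x : E,
    {y : E | y ≠ x ∧ ∃ s ∈ faces, x ∈ s ∧ y ∈ s}.encard ≤ N

/-- The `n`-simplices of the complex. -/
abbrev BoundedGeometryComplex.Top {n : ℕ} (K : BoundedGeometryComplex E n) : Type u :=
  {T : Finset E // T ∈ K.faces ∧ T.card = n + 1}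

/-- The ordered `k`-simplices `(v₀, …, v_k)` of the complex. -/
abbrev BoundedGeometryComplex.OrderedSimplex {n : ℕ} (K : BoundedGeometryComplex E n) (k : ℕ) :
    Type u :=
  {v : Fin (k + 1) ↪ E // Finset.univ.map v ∈ K.faces}

/-- A sequence of exponents `p₀, …, p_n` in `(1, ∞)`. -/
structure ExponentSequence (n : ℕ) where
  val : Fin (n + 1) → ℝ
  one_lt : ∀ i, 1 < val i

/-- The exponent `p_k`.  For `k > n` (where all differential forms vanish) it is set to `p_n`. -/
def ExponentSequence.exponent {n : ℕ} (π : ExponentSequence n) (k : ℕ) : ℝ≥0∞ :=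
  ENNReal.ofReal (π.val ⟨min k n, Nat.lt_succ_of_le (min_le_right k n)⟩)

instance {n : ℕ} (π : ExponentSequence n) (k : ℕ) : Fact (1 ≤ π.exponent k) :=
  ⟨by simpa [ExponentSequence.exponent] using (π.one_lt _).le⟩

/-! ### Differential forms on a simplex -/

/-- The closed simplex with vertex set `s`. -/
abbrev closedSimplex (s : Finset E) : Set E := convexHull ℝ (s : Set E)

/-- The space of vectors tangent to the simplex with vertex set `s`, with the norm of `E`. -/
def SimplexTangent (s : Finset E) : Type u := vectorSpan ℝ (s : Set E)

instance (s : Finset E) : NormedAddCommGroup (SimplexTangent s) :=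
  inferInstanceAs (NormedAddCommGroup (vectorSpan ℝ (s : Set E)))

instance (s : Finset E) : InnerProductSpace ℝ (SimplexTangent s) :=
  inferInstanceAs (InnerProductSpace ℝ (vectorSpan ℝ (s : Set E)))

/-- The inclusion of the tangent vectors into the ambient space. -/
def SimplexTangent.toAmbient (s : Finset E) : SimplexTangent s →L[ℝ] E :=
  (vectorSpan ℝ (s : Set E)).subtypeL

/-- The inclusion of the tangent vectors of a face into those of the simplex. -/
def SimplexTangent.inclusion {s t : Finset E} (h : s ⊆ t) :
    SimplexTangent s →L[ℝ] SimplexTangent t :=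
  (SimplexTangent.toAmbient s).codRestrict (vectorSpan ℝ (t : Set E))
    fun v => vectorSpan_mono ℝ (Finset.coe_subset.2 h) v.2

theorem SimplexTangent.norm_inclusion_le {s t : Finset E} (h : s ⊆ t) :
    ‖SimplexTangent.inclusion h‖ ≤ 1 :=
  ContinuousLinearMap.opNorm_le_bound _ zero_le_one fun v => (one_mul ‖v‖).symm ▸ le_rfl

instance (s : Finset E) : CompactSpace (closedSimplex s) :=
  isCompact_iff_compactSpace.1 (s.finite_toSet.isCompact_convexHull ℝ)

/-- Continuous differential `k`-forms on a closed simplex, a Banach space with the norm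
`sup_x |α(x)|`. -/
def SimplexForm (s : Finset E) (k : ℕ) : Type u :=
  C(closedSimplex s, SimplexTangent s [⋀^Fin k]→L[ℝ] ℝ)

namespace SimplexForm

instance (s : Finset E) (k : ℕ) : NormedAddCommGroup (SimplexForm s k) :=
  inferInstanceAs (NormedAddCommGroup C(closedSimplex s, SimplexTangent s [⋀^Fin k]→L[ℝ] ℝ))

instance (s : Finset E) (k : ℕ) : NormedSpace ℝ (SimplexForm s k) :=
  inferInstanceAs (NormedSpace ℝ C(closedSimplex s, SimplexTangent s [⋀^Fin k]→L[ℝ] ℝ))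

instance (s : Finset E) (k : ℕ) : CompleteSpace (SimplexForm s k) :=
  inferInstanceAs (CompleteSpace C(closedSimplex s, SimplexTangent s [⋀^Fin k]→L[ℝ] ℝ))

instance (s : Finset E) (k : ℕ) :
    FunLike (SimplexForm s k) (closedSimplex s) (SimplexTangent s [⋀^Fin k]→L[ℝ] ℝ) :=
  inferInstanceAs (FunLike C(closedSimplex s, SimplexTangent s [⋀^Fin k]→L[ℝ] ℝ) _ _)

theorem continuous {s : Finset E} {k : ℕ} (α : SimplexForm s k) : Continuous α :=
  ContinuousMap.continuous α

theorem norm_apply_le {s : Finset E} {k : ℕ} (α : SimplexForm s k) (x : closedSimplex s) :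
    ‖α x‖ ≤ ‖α‖ :=
  ContinuousMap.norm_coe_le_norm _ x

end SimplexForm

/-- The restriction (pullback) of forms from a simplex to a face of it. -/
def SimplexForm.restrict {s t : Finset E} (h : s ⊆ t) (k : ℕ) :
    SimplexForm t k →L[ℝ] SimplexForm s k :=
  LinearMap.mkContinuous
    { toFun := fun α => ContinuousMap.mk
        (fun x => (α ⟨x, convexHull_mono (Finset.coe_subset.2 h) x.2⟩).compContinuousLinearMap
          (SimplexTangent.inclusion h))
        ((ContinuousAlternatingMap.compContinuousLinearMapCLM
          (SimplexTangent.inclusion h)).continuous.comp (α.continuous.comp (by fun_prop)))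
      map_add' := fun _ _ => rfl
      map_smul' := fun _ _ => rfl }
    1 (fun α => by
      rw [one_mul]
      refine (ContinuousMap.norm_le _ (norm_nonneg α)).2 fun x => ?_
      refine (ContinuousAlternatingMap.norm_compContinuousLinearMap_le _ _).trans ?_
      refine (mul_le_of_le_one_right (norm_nonneg _) ?_).trans (α.norm_apply_le _)
      exact pow_le_one₀ (norm_nonneg _) (SimplexTangent.norm_inclusion_le h))

/-- The form `α` on a simplex is the restriction of the form `Ω` on the ambient space. -/
def SimplexForm.IsRestriction {s : Finset E} {k : ℕ} (Ω : E → E [⋀^Fin k]→L[ℝ] ℝ)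
    (α : SimplexForm s k) : Prop :=
  ∀ x, α x = (Ω x).compContinuousLinearMap (SimplexTangent.toAmbient s)

/-- The form `α` on the closed simplex is smooth (up to the boundary) and `η` is its exterior
derivative `dα`. -/
def SimplexForm.IsSmoothWithDeriv {s : Finset E} {k : ℕ} (α : SimplexForm s k)
    (η : SimplexForm s (k + 1)) : Prop :=
  ∃ Ω : E → E [⋀^Fin k]→L[ℝ] ℝ, ContDiff ℝ (⊤ : ℕ∞) Ω ∧ α.IsRestriction Ω ∧
    η.IsRestriction (extDeriv Ω)

/-! ### The complex `SL_π(K)` -/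

variable {n : ℕ}

/-- A family of forms on the `n`-simplices of `K` is compatible if any two members have the same
restriction to each common face. -/
def Compatible (K : BoundedGeometryComplex E n) {k : ℕ}
    (α : ∀ T : K.Top, SimplexForm T.1 k) : Prop :=
  ∀ (T T' : K.Top) (s : Finset E) (h : s ⊆ T.1) (h' : s ⊆ T'.1),
    SimplexForm.restrict h k (α T) = SimplexForm.restrict h' k (α T')

/-- The Banach space of families `(α_T)` of continuous forms of degree `k` on the `n`-simplices `T`
of `K`, with the norm `(∑_T (sup_T |α_T|)^{p_k})^{1/p_k}`. -/
abbrev FormFamilies (K : BoundedGeometryComplex E n) (π : ExponentSequence n) (k : ℕ) : Type u :=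
  lp (fun T : K.Top => SimplexForm T.1 k) (π.exponent k)

instance (K : BoundedGeometryComplex E n) (π : ExponentSequence n) (k : ℕ) :
    NormedAddCommGroup (FormFamilies K π k) := lp.normedAddCommGroup

instance (K : BoundedGeometryComplex E n) (π : ExponentSequence n) (k : ℕ) :
    NormedSpace ℝ (FormFamilies K π k) := lp.instNormedSpace

/-- The Banach space of pairs `(α, η)` of families of continuous forms of degrees `k`, `k + 1`
on the `n`-simplices `T` of `K`, with the norm
`(∑_T (sup_T |α|)^{p_k})^{1/p_k} + (∑_T (sup_T |η|)^{p_{k+1}})^{1/p_{k+1}}`. -/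
abbrev FormPairs (K : BoundedGeometryComplex E n) (π : ExponentSequence n) (k : ℕ) : Type u :=
  WithLp 1 (FormFamilies K π k × FormFamilies K π (k + 1))

/-- The space of the forms `α` of degree `k` on `K` that are smooth on any simplex and have a
finite norm `‖α‖ + ‖dα‖`, where `α` is recorded as the pair `(α, dα)`.  (Compatibility of `dα`
follows from that of `α`.) -/
def smoothForms (K : BoundedGeometryComplex E n) (π : ExponentSequence n) (k : ℕ) :
    Submodule ℝ (FormPairs K π k) where
  carrier := {z | (∀ T, SimplexForm.IsSmoothWithDeriv (z.fst T) (z.snd T)) ∧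
    Compatible K (fun T => z.fst T) ∧ Compatible K (fun T => z.snd T)}
  add_mem' := by
    rintro a b ⟨ha, ha1, ha2⟩ ⟨hb, hb1, hb2⟩
    refine ⟨fun T => ?_, fun T T' s h h' => ?_, fun T T' s h h' => ?_⟩
    · obtain ⟨A, hA, hA1, hA2⟩ := ha T
      obtain ⟨B, hB, hB1, hB2⟩ := hb T
      refine ⟨A + B, hA.add hB, fun x => ?_, fun x => ?_⟩
      · change a.fst T x + b.fst T x = _
        rw [hA1, hB1]; rfl
      · change a.snd T x + b.snd T x = _
        rw [hA2, hB2, extDeriv_add ((hA.differentiable (by simp)) _)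
          ((hB.differentiable (by simp)) _)]; rfl
    · change SimplexForm.restrict h k (a.fst T + b.fst T) =
        SimplexForm.restrict h' k (a.fst T' + b.fst T')
      rw [map_add, map_add, ha1 T T' s h h', hb1 T T' s h h']
    · change SimplexForm.restrict h _ (a.snd T + b.snd T) =
        SimplexForm.restrict h' _ (a.snd T' + b.snd T')
      rw [map_add, map_add, ha2 T T' s h h', hb2 T T' s h h']
  zero_mem' := by
    refine ⟨fun T => ⟨0, contDiff_const, fun x => rfl, fun x => ?_⟩, fun T T' s h h' => ?_,
      fun T T' s h h' => ?_⟩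
    · have h0 : extDeriv (0 : E → E [⋀^Fin k]→L[ℝ] ℝ) (x : E) = 0 := by
        simpa using extDeriv_smul (x := (x : E)) (0 : ℝ) (0 : E → E [⋀^Fin k]→L[ℝ] ℝ)
      rw [h0]; rfl
    · exact (map_zero _).trans (map_zero _).symm
    · exact (map_zero _).trans (map_zero _).symm
  smul_mem' := by
    rintro c a ⟨ha, ha1, ha2⟩
    refine ⟨fun T => ?_, fun T T' s h h' => ?_, fun T T' s h h' => ?_⟩
    · obtain ⟨A, hA, hA1, hA2⟩ := ha T
      refine ⟨c • A, hA.const_smul c, fun x => ?_, fun x => ?_⟩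
      · change c • a.fst T x = _
        rw [hA1]; rfl
      · change c • a.snd T x = _
        rw [hA2, extDeriv_smul]; rfl
    · change SimplexForm.restrict h k (c • a.fst T) = SimplexForm.restrict h' k (c • a.fst T')
      rw [map_smul, map_smul, ha1 T T' s h h']
    · change SimplexForm.restrict h _ (c • a.snd T) = SimplexForm.restrict h' _ (c • a.snd T')
      rw [map_smul, map_smul, ha2 T T' s h h']

/-- The Banach space `SL^k_π(K)`: the closure of the space of forms that are smooth on any
simplex. -/
abbrev SL (K : BoundedGeometryComplex E n) (π : ExponentSequence n) (k : ℕ) : Type u :=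
  (smoothForms K π k).topologicalClosure

/-- The map `(α, η) ↦ (η, 0)`. -/
def pairDifferential (K : BoundedGeometryComplex E n) (π : ExponentSequence n) (k : ℕ) :
    FormPairs K π k →L[ℝ] FormPairs K π (k + 1) :=
  (WithLp.prodContinuousLinearEquiv 1 ℝ (FormFamilies K π (k + 1))
      (FormFamilies K π (k + 1 + 1))).symm.toContinuousLinearMap ∘L
    (ContinuousLinearMap.inl ℝ (FormFamilies K π (k + 1)) (FormFamilies K π (k + 1 + 1))) ∘L
    (WithLp.sndL 1 ℝ (FormFamilies K π k) (FormFamilies K π (k + 1)))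

theorem pairDifferential_mem_smoothForms (K : BoundedGeometryComplex E n)
    (π : ExponentSequence n) (k : ℕ) {z : FormPairs K π k} (hz : z ∈ smoothForms K π k) :
    pairDifferential K π k z ∈ smoothForms K π (k + 1) := by
  obtain ⟨h1, -, h3⟩ := hz
  refine ⟨fun T => ?_, h3, fun T T' s h h' => (map_zero _).trans (map_zero _).symm⟩
  obtain ⟨A, hA, -, hA2⟩ := h1 T
  refine ⟨extDeriv A, ?_, hA2, fun x => ?_⟩
  · have h : ContDiff ℝ (⊤ : ℕ∞) (fderiv ℝ A) := hA.fderiv_right (by simp)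
    exact (ContinuousAlternatingMap.alternatizeUncurryFinCLM ℝ E ℝ).contDiff.comp h
  · rw [extDeriv_extDeriv hA (by simp; exact WithTop.coe_le_coe.2 le_top)]; rfl

theorem pairDifferential_mem_closure (K : BoundedGeometryComplex E n)
    (π : ExponentSequence n) (k : ℕ) (z : FormPairs K π k)
    (hz : z ∈ (smoothForms K π k).topologicalClosure) :
    pairDifferential K π k z ∈ (smoothForms K π (k + 1)).topologicalClosure :=
  map_mem_closure (pairDifferential K π k).continuous hz
    fun _ h => pairDifferential_mem_smoothForms K π k h

/-- The differential `d : SL^k_π(K) → SL^{k+1}_π(K)`, that is, `(α, dα) ↦ (dα, 0)`. -/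
def SL.d (K : BoundedGeometryComplex E n) (π : ExponentSequence n) (k : ℕ) :
    SL K π k →L[ℝ] SL K π (k + 1) :=
  (pairDifferential K π k).restrict (pairDifferential_mem_closure K π k)

theorem SL.d_d (K : BoundedGeometryComplex E n) (π : ExponentSequence n) (k : ℕ) (z : SL K π k) :
    SL.d K π (k + 1) (SL.d K π k z) = 0 := rfl

/-! ### The de Rham map and its kernel -/

/-- The standard `k`-simplex `{t ∈ ℝ^k | t_i ≥ 0, ∑ t_i ≤ 1}`. -/
def cornerSimplex (k : ℕ) : Set (Fin k → ℝ) := {t | (∀ i, 0 ≤ t i) ∧ ∑ i, t i ≤ 1}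

/-- The affine parametrization `t ↦ v₀ + ∑ t_i (v_i - v₀)` of the simplex with the ordered
vertices `v₀, …, v_k`. -/
def simplexParam {k : ℕ} (v : Fin (k + 1) ↪ E) (t : cornerSimplex k) :
    closedSimplex (Finset.univ.map v) :=
  ⟨v 0 + ∑ i, t.1 i • (v i.succ - v 0), by
    have hc := convex_convexHull ℝ ((Finset.univ.map v : Finset E) : Set E)
    have hv : ∀ i, v i ∈ convexHull ℝ ((Finset.univ.map v : Finset E) : Set E) :=
      fun i => subset_convexHull ℝ _ (by simp)
    have key : v 0 + ∑ i, t.1 i • (v i.succ - v 0) =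
        ∑ i : Fin (k + 1), (Fin.cons (1 - ∑ i, t.1 i) t.1 : Fin (k + 1) → ℝ) i • v i := by
      simp only [Fin.sum_univ_succ, Fin.cons_zero, Fin.cons_succ, smul_sub,
        Finset.sum_sub_distrib, ← Finset.sum_smul, sub_smul, one_smul]
      abel
    rw [key]
    refine hc.sum_mem (fun i _ => ?_) ?_ fun i _ => hv i
    · refine Fin.cases ?_ (fun j => ?_) i
      · simpa using t.2.2
      · simpa using t.2.1 j
    · simp [Fin.sum_univ_succ]⟩

theorem continuous_simplexParam {k : ℕ} (v : Fin (k + 1) ↪ E) : Continuous (simplexParam v) :=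
  Continuous.subtype_mk (continuous_const.add (continuous_finsetSum _ fun i _ =>
    ((continuous_apply i).comp continuous_subtype_val).smul continuous_const)) _

/-- The tangent vector `v_{i+1} - v₀`, the `i`-th partial derivative of the parametrization. -/
def simplexFrame {k : ℕ} (v : Fin (k + 1) ↪ E) (i : Fin k) :
    SimplexTangent (Finset.univ.map v) :=
  ⟨v i.succ - v 0, vsub_mem_vectorSpan ℝ (by simp) (by simp)⟩

instance (k : ℕ) : CompactSpace (cornerSimplex k) := by
  refine isCompact_iff_compactSpace.1 (Metric.isCompact_of_isClosed_isBounded ?_ ?_)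
  · have h : cornerSimplex k = (⋂ i, {t | 0 ≤ t i}) ∩ {t | ∑ i, t i ≤ 1} := by
      ext t; simp [cornerSimplex]
    rw [h]
    exact (isClosed_iInter fun i => isClosed_le continuous_const (continuous_apply i)).inter
      (isClosed_le (by fun_prop) continuous_const)
  · refine (Metric.isBounded_Icc (0 : Fin k → ℝ) 1).subset fun t ht => ⟨ht.1, fun i => ?_⟩
    exact (Finset.single_le_sum (fun j _ => ht.1 j) (Finset.mem_univ i)).trans ht.2

/-- Lebesgue measure on the standard simplex. -/
def cornerMeasure (k : ℕ) : MeasureTheory.Measure (cornerSimplex k) :=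
  MeasureTheory.volume.comap Subtype.val

instance (k : ℕ) : MeasureTheory.IsFiniteMeasure (cornerMeasure k) := by
  have hc : IsCompact (cornerSimplex k) := isCompact_iff_compactSpace.2 inferInstance
  refine ⟨?_⟩
  rw [cornerMeasure, comap_subtype_coe_apply hc.measurableSet, Set.image_univ,
    Subtype.range_coe]
  exact hc.measure_lt_top

/-- The integrand of the integral of a `k`-form over an ordered `k`-simplex. -/
theorem continuous_simplexIntegrand {k : ℕ} (v : Fin (k + 1) ↪ E)
    (α : SimplexForm (Finset.univ.map v) k) :
    Continuous fun t => α (simplexParam v t) (simplexFrame v) :=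
  (continuous_eval_const (simplexFrame v)).comp (α.continuous.comp (continuous_simplexParam v))

theorem integrable_simplexIntegrand {k : ℕ} (v : Fin (k + 1) ↪ E)
    (α : SimplexForm (Finset.univ.map v) k) :
    MeasureTheory.Integrable (fun t => α (simplexParam v t) (simplexFrame v)) (cornerMeasure k) :=
  (continuous_simplexIntegrand v α).integrable_of_hasCompactSupport
    (HasCompactSupport.of_compactSpace _)

/-- The integral `∫_{[v₀, …, v_k]} α` of a `k`-form over the `k`-simplex with the ordered vertices
`v₀, …, v_k`. -/
def simplexIntegral {k : ℕ} (v : Fin (k + 1) ↪ E) :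
    SimplexForm (Finset.univ.map v) k →L[ℝ] ℝ :=
  LinearMap.mkContinuous
    { toFun := fun α => ∫ t, α (simplexParam v t) (simplexFrame v) ∂(cornerMeasure k)
      map_add' := fun α β => MeasureTheory.integral_add (integrable_simplexIntegrand v α)
        (integrable_simplexIntegrand v β)
      map_smul' := fun c α => MeasureTheory.integral_const_mul c _ }
    ((∏ i, ‖simplexFrame v i‖) * (cornerMeasure k).real Set.univ) fun α => by
      refine (MeasureTheory.norm_integral_le_of_norm_le_const
        (C := ‖α‖ * ∏ i, ‖simplexFrame v i‖) (Filter.Eventually.of_forall fun t => ?_)).trans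
          (le_of_eq (by ring))
      exact ((α (simplexParam v t)).le_opNorm _).trans
        (mul_le_mul_of_nonneg_right (α.norm_apply_le _) (Finset.prod_nonneg fun _ _ =>
          norm_nonneg _))

/-- An `n`-simplex of `K` that has a given simplex as a face. -/
def BoundedGeometryComplex.top (K : BoundedGeometryComplex E n) {k : ℕ}
    (v : K.OrderedSimplex k) : K.Top :=
  ⟨(K.pure _ v.2).choose, (K.pure _ v.2).choose_spec.1, (K.pure _ v.2).choose_spec.2.2⟩

theorem BoundedGeometryComplex.subset_top (K : BoundedGeometryComplex E n) {k : ℕ}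
    (v : K.OrderedSimplex k) : Finset.univ.map v.1 ⊆ (K.top v).1 :=
  (K.pure _ v.2).choose_spec.2.1

/-- The de Rham map `I`, sending a form `α` of degree `k` on `K` to the simplicial cochain
`σ ↦ ∫_σ α`, a function of the ordered `k`-simplices `σ`.  As the members of `α` on the various
`n`-simplices are compatible, it does not matter from which `n`-simplex containing `σ` the form
`α` is restricted to `σ`. -/
def deRhamMap (K : BoundedGeometryComplex E n) (π : ExponentSequence n) (k : ℕ) :
    SL K π k →L[ℝ] (K.OrderedSimplex k → ℝ) :=
  ContinuousLinearMap.pi fun v =>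
    simplexIntegral v.1 ∘L SimplexForm.restrict (K.subset_top v) k ∘L
      lp.evalCLM ℝ (fun T : K.Top => SimplexForm T.1 k) (π.exponent k) (K.top v) ∘L
        WithLp.fstL 1 ℝ (FormFamilies K π k) (FormFamilies K π (k + 1)) ∘L
          (smoothForms K π k).topologicalClosure.subtypeL

/-- The Banach space `ker^k_π I`, the kernel of the de Rham map in degree `k`. -/
abbrev kerDeRham (K : BoundedGeometryComplex E n) (π : ExponentSequence n) (k : ℕ) :
    Submodule ℝ (SL K π k) :=
  (deRhamMap K π k).ker

/-- The property that the spaces `ker^k_π I` form a subcomplex of `SL_π(K)`. -/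
def KerIsSubcomplex (K : BoundedGeometryComplex E n) (π : ExponentSequence n) : Prop :=
  ∀ k, ∀ α ∈ kerDeRham K π k, SL.d K π k α ∈ kerDeRham K π (k + 1)

instance (K : BoundedGeometryComplex E n) (π : ExponentSequence n) (k : ℕ) :
    CompleteSpace (SL K π k) :=
  (smoothForms K π k).isClosed_topologicalClosure.completeSpace_coe

instance (K : BoundedGeometryComplex E n) (π : ExponentSequence n) (k : ℕ) :
    CompleteSpace (kerDeRham K π k) :=
  (deRhamMap K π k).isClosed_ker.completeSpace_coe

/-- The complex `0 → ker^0_π I → ker^1_π I → ⋯` of Banach spaces and bounded maps, with the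
differential of `SL_π(K)`. -/
def kerComplex (K : BoundedGeometryComplex E n) (π : ExponentSequence n)
    (hd : KerIsSubcomplex K π) : CochainComplex Ban.{u} ℕ :=
  CochainComplex.of (fun k => ⟨kerDeRham K π k⟩)
    (fun k => ((SL.d K π k).restrict (hd k) : kerDeRham K π k →L[ℝ] kerDeRham K π (k + 1)))
    (fun _ => rfl)

/-- The zero complex of Banach spaces. -/
def zeroComplex : CochainComplex Ban.{u} ℕ := HomologicalComplex.zero

end

/-!
The complex `ker_π I` is contracted by an explicit homotopy which acts on each `n`-simplex
separately.  It is Dupont's contraction of the forms on a simplex onto the Whitney forms.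

Let `t_v` be the barycentric coordinate of the vertex `v` of a simplex, and let `h_v` be the cone
operator with apex `v`, for which `d h_v + h_v d = 1` in positive degrees and `h_v d f = f - f(v)`
on functions.  With the operators `R` defined by
`R = 1` in degree `0` and `R α = α - ∑ dt_v ∧ R h_v α`, put

* `S α = ∑ t_v R h_v α` (`SimplexForm.dupont`),
* `W α = ∑ t_v (R d - d R) h_v α` in positive degrees, and `W f = ∑ f(v) t_v` on functions
  (`SimplexForm.whitney`).

As `∑ t_v = 1` and `∑ dt_v = 0`, these satisfy `d S + S d = 1 - W`
(`SimplexForm.IsSmoothWithDeriv.dupont`).  The commutator `R d - d R` is itself a sum of terms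
`dt_{i₁} ∧ ⋯ ∧ dt_{i_p}` times the value at a vertex of an iterated cone, so that `W α` only depends
on such values.  The integral of `h_v α` over a face is up to sign the integral of `α` over the join
of this face with `v` (`SimplexForm.tupleIntegral_cone`); hence the values in question are integrals
of `α` over faces, and `W` vanishes on the kernel of the de Rham map
(`SimplexForm.FaceIntegralsVanish.whitney_eq_zero`).  The same formula for the join yields the part
of Stokes' theorem which shows that `d` preserves the kernel
(`SimplexForm.FaceIntegralsVanish.of_mem_weakPairs`).

The cones, the coordinates `t_v` and their differentials are compatible with the restriction to
faces, and `t_v` and `dt_v` restrict to zero on the faces that do not contain `v`; so `S` and `W`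
commute with restrictions (`SimplexForm.restrict_dupont`, `SimplexForm.restrict_whitney`) and act on
compatible families.  Moreover `S α` has vanishing integral over a `k`-simplex, as it depends there
only on the restriction of a form of degree `k + 1`.  Since all edges have length `1`, the norms of
`S` and `W` are bounded by constants which depend only on the dimension and the degree.  Together
with the inclusions `ℓ^p ⊆ ℓ^q` for `p ≤ q`, this makes
`(α, η) ↦ (S α, α - S η - W α)` a bounded operator from pairs `(α, dα)` in degree `k + 1` to pairs
in degree `k`; it preserves the closure of the smooth forms and restricts to the contraction of
`ker_π I` (`BoundedGeometryComplex.homotopyKer`).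
-/

noncomputable section

/-! ### Exterior multiplication by a covector -/

namespace ContinuousAlternatingMap

variable {V V' : Type*} [NormedAddCommGroup V] [NormedSpace ℝ V]
  [NormedAddCommGroup V'] [NormedSpace ℝ V'] {k : ℕ}

/-- Exterior multiplication `α ↦ θ ∧ α` by a covector `θ`, without a normalising factor:
`(θ ∧ α)(v₀, …, v_k) = ∑ᵢ (-1)ⁱ θ(vᵢ) α(v₀, …, v̂ᵢ, …, v_k)`. -/
def wedgeCovector (θ : V →L[ℝ] ℝ) : V [⋀^Fin k]→L[ℝ] ℝ →L[ℝ] V [⋀^Fin (k + 1)]→L[ℝ] ℝ :=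
  alternatizeUncurryFinCLM ℝ V ℝ ∘L
    ContinuousLinearMap.smulRightL ℝ V (V [⋀^Fin k]→L[ℝ] ℝ) θ

theorem wedgeCovector_def (θ : V →L[ℝ] ℝ) (α : V [⋀^Fin k]→L[ℝ] ℝ) :
    wedgeCovector θ α = alternatizeUncurryFin (θ.smulRight α) := rfl

theorem wedgeCovector_apply (θ : V →L[ℝ] ℝ) (α : V [⋀^Fin k]→L[ℝ] ℝ) (v : Fin (k + 1) → V) :
    wedgeCovector θ α v =
      ∑ i : Fin (k + 1), (-1) ^ (i : ℕ) • (θ (v i) * α (i.removeNth v)) := by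
  simp [wedgeCovector_def, alternatizeUncurryFin_apply]

theorem wedgeCovector_zero : wedgeCovector (k := k) (0 : V →L[ℝ] ℝ) = 0 := by
  ext α v; simp [wedgeCovector_apply]

theorem wedgeCovector_sum {ι : Type*} (s : Finset ι) (θ : ι → V →L[ℝ] ℝ)
    (α : V [⋀^Fin k]→L[ℝ] ℝ) :
    ∑ i ∈ s, wedgeCovector (θ i) α = wedgeCovector (∑ i ∈ s, θ i) α := by
  exact (_root_.map_sum (alternatizeUncurryFinCLM ℝ V ℝ ∘L
    (ContinuousLinearMap.smulRightL ℝ V (V [⋀^Fin k]→L[ℝ] ℝ)).flip α) θ s).symm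

theorem wedgeCovector_compContinuousLinearMap (θ : V' →L[ℝ] ℝ) (α : V' [⋀^Fin k]→L[ℝ] ℝ)
    (j : V →L[ℝ] V') :
    (wedgeCovector θ α).compContinuousLinearMap j =
      wedgeCovector (θ ∘L j) (α.compContinuousLinearMap j) := by
  ext v
  simp only [compContinuousLinearMap_apply, wedgeCovector_apply, ContinuousLinearMap.comp_apply,
    Function.comp_apply]
  rfl

theorem norm_wedgeCovector_le (θ : V →L[ℝ] ℝ) :
    ‖wedgeCovector (k := k) θ‖ ≤ (k + 1) * ‖θ‖ := by
  refine ContinuousLinearMap.opNorm_le_bound _ (by positivity) fun α => ?_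
  rw [wedgeCovector_def, mul_assoc]
  exact (norm_alternatizeUncurryFin_le _).trans (by rw [ContinuousLinearMap.norm_smulRight_apply])

/-- Contraction of an alternatized map with a vector. -/
theorem curryLeft_alternatizeUncurryFin (A : V →L[ℝ] V [⋀^Fin (k + 1)]→L[ℝ] ℝ) (w : V) :
    (alternatizeUncurryFin A).curryLeft w =
      A w - alternatizeUncurryFin
        ((ContinuousLinearMap.apply ℝ (V [⋀^Fin k]→L[ℝ] ℝ) w ∘L
          curryLeftLI.toContinuousLinearMap) ∘L A) := by
  ext v
  rw [curryLeft_apply_apply, sub_apply, alternatizeUncurryFin_apply, alternatizeUncurryFin_apply,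
    Fin.sum_univ_succ, sub_eq_add_neg, ← Finset.sum_neg_distrib]
  congr 1
  · simp [Matrix.vecCons]
  · refine Finset.sum_congr rfl fun i _ => ?_
    have h : (Fin.succ i).removeNth (Matrix.vecCons w v : Fin (k + 2) → V) =
        Matrix.vecCons w (i.removeNth v) := by
      funext m
      refine Fin.cases ?_ (fun m => ?_) m
      · simp [Fin.removeNth]
      · simp [Fin.removeNth]
    rw [h]
    simp [pow_succ]

theorem curryLeft_alternatizeUncurryFin_zero (A : V →L[ℝ] V [⋀^Fin 0]→L[ℝ] ℝ) (w : V) :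
    (alternatizeUncurryFin A).curryLeft w = A w := by
  ext v
  rw [curryLeft_apply_apply, alternatizeUncurryFin_apply]
  simp [Matrix.vecCons, Subsingleton.elim _ v]

/-- Exterior multiplication by a covector anticommutes with alternation; this is the identity
`d(θ ∧ α) = -θ ∧ dα` for a constant covector `θ`. -/
theorem alternatizeUncurryFin_wedgeCovector_comp (θ : V →L[ℝ] ℝ)
    (A : V →L[ℝ] V [⋀^Fin k]→L[ℝ] ℝ) :
    alternatizeUncurryFin (wedgeCovector θ ∘L A) = -wedgeCovector θ (alternatizeUncurryFin A) := by
  -- the bilinear map `(v, w) ↦ θ(w) A(v) + θ(v) A(w)` is symmetric, so its alternation vanishes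
  let f : V →L[ℝ] V →L[ℝ] V [⋀^Fin k]→L[ℝ] ℝ :=
    ContinuousLinearMap.smulRightL ℝ V (V [⋀^Fin k]→L[ℝ] ℝ) θ ∘L A + θ.smulRight A
  have hf : ∀ v w, f v w = f w v := fun v w => by
    simp [f, add_comm]
  have h := alternatizeUncurryFin_alternatizeUncurryFinCLM_comp_of_symmetric hf
  rw [ContinuousLinearMap.comp_add, alternatizeUncurryFin_add] at h
  rw [wedgeCovector_def, ← add_eq_zero_iff_eq_neg, ← h]
  congr 2
  ext v w
  simp

end ContinuousAlternatingMap

/-! ### Integrals over the unit interval depending on a parameter -/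

section

open MeasureTheory Topology

theorem Continuous.integrable_unitInterval {F : Type*} [NormedAddCommGroup F]
    {f : unitInterval → F} (hf : Continuous f) : Integrable f :=
  hf.integrable_of_hasCompactSupport (HasCompactSupport.of_compactSpace _)

theorem integral_unitInterval_eq_intervalIntegral {F : Type*} [NormedAddCommGroup F]
    [NormedSpace ℝ F] (f : ℝ → F) : ∫ u : unitInterval, f u = ∫ t in (0 : ℝ)..1, f t := by
  rw [intervalIntegral.integral_of_le zero_le_one, ← integral_Icc_eq_integral_Ioc]
  exact integral_subtype_comap measurableSet_Icc f

section Parametric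

variable {X F : Type u} [NormedAddCommGroup X] [NormedSpace ℝ X] [NormedAddCommGroup F]
  [NormedSpace ℝ F]

/-- Differentiation under the integral sign over the compact unit interval. -/
theorem hasFDerivAt_integral_unitInterval {g : X × ℝ → F} {g' : X × ℝ → X →L[ℝ] F}
    (hg : Continuous g) (hg' : Continuous g')
    (h : ∀ x t, HasFDerivAt (fun x => g (x, t)) (g' (x, t)) x) (x₀ : X) :
    HasFDerivAt (fun x => ∫ u : unitInterval, g (x, u)) (∫ u : unitInterval, g' (x₀, u)) x₀ := by
  -- by compactness, `g'` is bounded on the product of a neighbourhood of `x₀` with the interval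
  obtain ⟨C, hC⟩ := (isCompact_univ (X := unitInterval)).bddAbove_image
    (f := fun u : unitInterval => ‖g' (x₀, u)‖) (by fun_prop)
  obtain ⟨U, W, hU, -, hxU, hW, hUW⟩ := generalized_tube_lemma (isCompact_singleton (x := x₀))
    (isCompact_Icc (a := (0 : ℝ)) (b := 1)) (n := {p | ‖g' p‖ < C + 1})
    (isOpen_lt (by fun_prop) continuous_const) (by
      rintro ⟨x, t⟩ ⟨rfl, ht⟩
      exact (hC ⟨⟨t, ht⟩, trivial, rfl⟩).trans_lt (lt_add_one C))
  refine hasFDerivAt_integral_of_dominated_of_fderiv_le (s := U) (bound := fun _ => C + 1)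
    (F' := fun x (u : unitInterval) => g' (x, u))
    (hU.mem_nhds (hxU rfl)) (Filter.Eventually.of_forall fun x => ?_) ?_ ?_ ?_
    (integrable_const _) ?_
  · exact Continuous.aestronglyMeasurable (by fun_prop)
  · exact Continuous.integrable_unitInterval (by fun_prop)
  · exact Continuous.aestronglyMeasurable (by fun_prop)
  · exact Filter.Eventually.of_forall fun u x hx =>
      (hUW (Set.mk_mem_prod hx (hW u.2)) : ‖g' (x, u)‖ < C + 1).le
  · exact Filter.Eventually.of_forall fun u x _ => h x u

theorem contDiff_nat_integral_unitInterval (m : ℕ) : ∀ {F : Type u} [NormedAddCommGroup F]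
    [NormedSpace ℝ F] {g : X × ℝ → F}, ContDiff ℝ (⊤ : ℕ∞) g →
    ContDiff ℝ m (fun x => ∫ u : unitInterval, g (x, u)) := by
  have hd : ∀ {F : Type u} [NormedAddCommGroup F] [NormedSpace ℝ F] {g : X × ℝ → F},
      ContDiff ℝ (⊤ : ℕ∞) g → ∀ x₀, HasFDerivAt (fun x => ∫ u : unitInterval, g (x, u))
        (∫ u : unitInterval, fderiv ℝ g (x₀, u) ∘L ContinuousLinearMap.inl ℝ X ℝ) x₀ := by
    intro F _ _ g hg x₀
    have h1 : Continuous (fderiv ℝ g) := hg.continuous_fderiv (by simp)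
    exact hasFDerivAt_integral_unitInterval
      (g' := fun p => fderiv ℝ g p ∘L ContinuousLinearMap.inl ℝ X ℝ) hg.continuous
      (by fun_prop) (fun x t => ((hg.differentiable (by simp) _).hasFDerivAt).comp x
        (hasFDerivAt_prodMk_left x t)) x₀
  induction m with
  | zero =>
    intro F _ _ g hg
    exact contDiff_zero.2 (continuous_iff_continuousAt.2 fun x => (hd hg x).continuousAt)
  | succ m ih =>
    intro F _ _ g hg
    have h1 : ContDiff ℝ (⊤ : ℕ∞) (fderiv ℝ g) := hg.fderiv_right (by simp)
    exact contDiff_succ_iff_hasFDerivAt.2 ⟨_, ih (h1.clm_comp contDiff_const), hd hg⟩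

theorem contDiff_integral_unitInterval {g : X × ℝ → F} (hg : ContDiff ℝ (⊤ : ℕ∞) g) :
    ContDiff ℝ (⊤ : ℕ∞) (fun x => ∫ u : unitInterval, g (x, u)) :=
  contDiff_infty.2 fun m => contDiff_nat_integral_unitInterval m hg

end Parametric

/-! ### The cone operator and the Poincaré lemma -/

open ContinuousAlternatingMap

section Cone

variable {V V' : Type*} [NormedAddCommGroup V] [NormedSpace ℝ V]
  [NormedAddCommGroup V'] [NormedSpace ℝ V'] {k : ℕ}

/-- The integrand of the cone operator, as a bounded bilinear function of the form and the vector
that it is contracted with. -/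
def contractL : V [⋀^Fin (k + 1)]→L[ℝ] ℝ →L[ℝ] V →L[ℝ] V [⋀^Fin k]→L[ℝ] ℝ :=
  curryLeftLI.toContinuousLinearMap

@[simp]
theorem contractL_apply (α : V [⋀^Fin (k + 1)]→L[ℝ] ℝ) (w : V) :
    contractL α w = α.curryLeft w := rfl

theorem contDiff_contractL :
    ContDiff ℝ (⊤ : ℕ∞) fun α : V [⋀^Fin (k + 1)]→L[ℝ] ℝ => contractL α :=
  ContinuousLinearMap.contDiff _

theorem hasFDerivAt_contractL (α : V [⋀^Fin (k + 1)]→L[ℝ] ℝ) :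
    HasFDerivAt (fun α : V [⋀^Fin (k + 1)]→L[ℝ] ℝ => contractL α) contractL α :=
  ContinuousLinearMap.hasFDerivAt _

/-- The integral `∫₀¹ uᵏ ι_w f(u) du`, where `f` is a path of alternating maps of degree `k + 1`.
If `f(u)` is the value of a form at the point `e + u w`, then this is the value at `e + w` of the
form that is obtained by integration along the rays from `e`. -/
def coneIntegral (f : unitInterval → V [⋀^Fin (k + 1)]→L[ℝ] ℝ) (w : V) : V [⋀^Fin k]→L[ℝ] ℝ :=
  ∫ u : unitInterval, (u : ℝ) ^ k • contractL (f u) w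

theorem continuous_coneIntegrand {f : unitInterval → V [⋀^Fin (k + 1)]→L[ℝ] ℝ}
    (hf : Continuous f) (w : V) :
    Continuous fun u : unitInterval => (u : ℝ) ^ k • contractL (f u) w := by
  fun_prop

theorem coneIntegral_compContinuousLinearMap {f : unitInterval → V' [⋀^Fin (k + 1)]→L[ℝ] ℝ}
    (hf : Continuous f) (j : V →L[ℝ] V') (w : V) :
    (coneIntegral f (j w)).compContinuousLinearMap j =
      coneIntegral (fun u => (f u).compContinuousLinearMap j) w := by
  have h := (compContinuousLinearMapCLM (𝕜 := ℝ) (ι := Fin k) (F := ℝ) j).integral_comp_comm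
    (continuous_coneIntegrand hf (j w)).integrable_unitInterval
  refine h.symm.trans (integral_congr_ae (Filter.Eventually.of_forall fun u => ?_))
  ext v
  simp [← curryLeft_compContinuousLinearMap]

theorem coneIntegral_add {f g : unitInterval → V [⋀^Fin (k + 1)]→L[ℝ] ℝ}
    (hf : Continuous f) (hg : Continuous g) (w : V) :
    coneIntegral (fun u => f u + g u) w = coneIntegral f w + coneIntegral g w := by
  simp only [coneIntegral, map_add, _root_.add_apply, smul_add]
  exact integral_add (continuous_coneIntegrand hf w).integrable_unitInterval
    (continuous_coneIntegrand hg w).integrable_unitInterval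

theorem coneIntegral_smul (c : ℝ) (f : unitInterval → V [⋀^Fin (k + 1)]→L[ℝ] ℝ) (w : V) :
    coneIntegral (fun u => c • f u) w = c • coneIntegral f w := by
  simp only [coneIntegral, map_smul, _root_.smul_apply, smul_comm _ c]
  exact integral_smul c _

theorem norm_coneIntegral_le {f : unitInterval → V [⋀^Fin (k + 1)]→L[ℝ] ℝ} {C : ℝ}
    (hf : ∀ u, ‖f u‖ ≤ C) (w : V) : ‖coneIntegral f w‖ ≤ C * ‖w‖ := by
  refine (norm_integral_le_of_norm_le_const (C := C * ‖w‖)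
    (Filter.Eventually.of_forall fun u => ?_)).trans (by simp)
  have h1 : ‖(u : ℝ) ^ k‖ ≤ 1 := by
    rw [norm_pow]
    exact pow_le_one₀ (norm_nonneg _) (by rw [Real.norm_of_nonneg u.2.1]; exact u.2.2)
  rw [norm_smul]
  refine (mul_le_of_le_one_left (norm_nonneg _) h1).trans ((ContinuousLinearMap.le_opNorm _ _).trans
    (mul_le_mul_of_nonneg_right ?_ (norm_nonneg _)))
  exact (norm_curryLeft (f u)).le.trans (hf u)

end Cone

section Poincare

variable {E : Type u} [NormedAddCommGroup E] [NormedSpace ℝ E] {k : ℕ}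

/-- The cone operator with apex `e` on forms of positive degree. -/
def coneForm (e : E) (Ω : E → E [⋀^Fin (k + 1)]→L[ℝ] ℝ) (x : E) : E [⋀^Fin k]→L[ℝ] ℝ :=
  coneIntegral (fun u => Ω (e + (u : ℝ) • (x - e))) (x - e)

theorem contDiff_coneForm (e : E) {Ω : E → E [⋀^Fin (k + 1)]→L[ℝ] ℝ}
    (hΩ : ContDiff ℝ (⊤ : ℕ∞) Ω) : ContDiff ℝ (⊤ : ℕ∞) (coneForm e Ω) := by
  refine contDiff_integral_unitInterval
    (g := fun p : E × ℝ => p.2 ^ k • contractL (Ω (e + p.2 • (p.1 - e))) (p.1 - e)) ?_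
  have h1 : ContDiff ℝ (⊤ : ℕ∞) fun p : E × ℝ => Ω (e + p.2 • (p.1 - e)) :=
    hΩ.comp (by fun_prop)
  have h2 : ContDiff ℝ (⊤ : ℕ∞) fun p : E × ℝ => contractL (Ω (e + p.2 • (p.1 - e))) :=
    contDiff_contractL.comp h1
  have h3 : ContDiff ℝ (⊤ : ℕ∞) fun p : E × ℝ => p.1 - e := by fun_prop
  have h4 : ContDiff ℝ (⊤ : ℕ∞) fun p : E × ℝ => p.2 ^ k := by fun_prop
  exact h4.smul (h2.clm_apply h3)

theorem hasFDerivAt_coneForm (e : E) {Ω : E → E [⋀^Fin (k + 1)]→L[ℝ] ℝ}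
    (hΩ : ContDiff ℝ (⊤ : ℕ∞) Ω) (x : E) :
    HasFDerivAt (coneForm e Ω) (∫ u : unitInterval, (u : ℝ) ^ k •
      ((u : ℝ) • ((ContinuousLinearMap.apply ℝ _ (x - e) ∘L contractL) ∘L
        fderiv ℝ Ω (e + (u : ℝ) • (x - e))) + contractL (Ω (e + (u : ℝ) • (x - e))))) x := by
  have hc := hΩ.continuous
  have hc' : Continuous (fderiv ℝ Ω) := hΩ.continuous_fderiv (by simp)
  refine hasFDerivAt_integral_unitInterval
    (g := fun p : E × ℝ => p.2 ^ k • contractL (Ω (e + p.2 • (p.1 - e))) (p.1 - e))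
    (g' := fun p : E × ℝ => p.2 ^ k •
      (p.2 • ((ContinuousLinearMap.apply ℝ _ (p.1 - e) ∘L contractL) ∘L
        fderiv ℝ Ω (e + p.2 • (p.1 - e))) + contractL (Ω (e + p.2 • (p.1 - e)))))
    (by fun_prop) (by fun_prop) (fun x t => ?_) x
  have h1 : HasFDerivAt (fun x : E => x - e) (ContinuousLinearMap.id ℝ E) x :=
    (hasFDerivAt_id x).sub_const e
  have h2 : HasFDerivAt (fun x : E => e + t • (x - e)) (t • ContinuousLinearMap.id ℝ E) x :=
    (h1.const_smul t).const_add e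
  have h3 : HasFDerivAt (fun x : E => Ω (e + t • (x - e))) _ x :=
    ((hΩ.differentiable (by simp) (e + t • (x - e))).hasFDerivAt).comp x h2
  have h4 := HasFDerivAt.comp (G := E →L[ℝ] E [⋀^Fin k]→L[ℝ] ℝ) x
    (hasFDerivAt_contractL (Ω (e + t • (x - e)))) h3
  convert! (h4.clm_apply h1).const_smul (t ^ k) using 1
  ext v m
  simp [add_comm]

/-- The cone operator contracts the complex of forms in positive degrees: it satisfies
`d h + h d = 1`.  The integrand of `(d h + h d) Ω` is the derivative of
`u ↦ u ^ (k + 1) • Ω (e + u • (x - e))`. -/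
theorem extDeriv_coneForm (e : E) {Ω : E → E [⋀^Fin (k + 1)]→L[ℝ] ℝ}
    (hΩ : ContDiff ℝ (⊤ : ℕ∞) Ω) (x : E) :
    extDeriv (coneForm e Ω) x = Ω x - coneForm e (extDeriv Ω) x := by
  have hc := hΩ.continuous
  have hc' : Continuous (fderiv ℝ Ω) := hΩ.continuous_fderiv (by simp)
  have hcd : Continuous (extDeriv Ω) :=
    (alternatizeUncurryFinCLM ℝ E ℝ).continuous.comp hc'
  set y : ℝ → E := fun t => e + t • (x - e) with hy
  have hyc : Continuous y := by fun_prop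
  have hA : Continuous fun u : unitInterval => (u : ℝ) ^ k •
      ((u : ℝ) • ((ContinuousLinearMap.apply ℝ _ (x - e) ∘L contractL) ∘L fderiv ℝ Ω (y u)) +
        contractL (Ω (y u))) := by fun_prop
  have h1 : extDeriv (coneForm e Ω) x = ∫ u : unitInterval, alternatizeUncurryFinCLM ℝ E ℝ
      ((u : ℝ) ^ k • ((u : ℝ) • ((ContinuousLinearMap.apply ℝ _ (x - e) ∘L contractL) ∘L
        fderiv ℝ Ω (y u)) + contractL (Ω (y u)))) := by
    rw [extDeriv, (hasFDerivAt_coneForm e hΩ x).fderiv]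
    exact (ContinuousLinearMap.integral_comp_comm (𝕜 := ℝ) (Fₗ := E [⋀^Fin (k + 1)]→L[ℝ] ℝ)
      (alternatizeUncurryFinCLM ℝ E ℝ)
      (Continuous.integrable_unitInterval (F := E →L[ℝ] E [⋀^Fin k]→L[ℝ] ℝ) hA)).symm
  have h2 : ∀ t : ℝ, HasDerivAt (fun t : ℝ => t ^ (k + 1) • Ω (y t))
      (t ^ (k + 1) • fderiv ℝ Ω (y t) (x - e) + ((k + 1 : ℝ) * t ^ k) • Ω (y t)) t := by
    intro t
    have hy' : HasDerivAt y (x - e) t := by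
      simpa [hy] using ((hasDerivAt_id t).smul_const (x - e)).const_add e
    have h3 := ((hΩ.differentiable (by simp) (y t)).hasFDerivAt).comp_hasDerivAt t hy'
    refine ((hasDerivAt_pow (k + 1) t).smul h3).congr_deriv ?_
    simp
  have h4 : ∫ u : unitInterval, ((u : ℝ) ^ (k + 1) • fderiv ℝ Ω (y u) (x - e) +
      ((k + 1 : ℝ) * (u : ℝ) ^ k) • Ω (y u)) = Ω x := by
    rw [integral_unitInterval_eq_intervalIntegral (fun t : ℝ => t ^ (k + 1) •
      fderiv ℝ Ω (y t) (x - e) + ((k + 1 : ℝ) * t ^ k) • Ω (y t)),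
      intervalIntegral.integral_eq_sub_of_hasDerivAt (fun t _ => h2 t)
        (Continuous.intervalIntegrable (by fun_prop) _ _)]
    simp [hy]
  rw [eq_sub_iff_add_eq, h1, coneForm, coneIntegral, ← integral_add, ← h4]
  · refine integral_congr_ae (Filter.Eventually.of_forall fun u => ?_)
    simp only [contractL_apply, extDeriv, curryLeft_alternatizeUncurryFin, map_smul, map_add,
      alternatizeUncurryFinCLM_apply]
    have h5 : alternatizeUncurryFin (contractL (Ω (y u))) = (k + 1 : ℝ) • Ω (y u) := by
      refine (alternatizeUncurryFin_curryLeft _).trans ?_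
      norm_cast
    rw [h5]
    change _ + (u : ℝ) ^ (k + 1) • (fderiv ℝ Ω (y u) (x - e) - alternatizeUncurryFin
      ((ContinuousLinearMap.apply ℝ _ (x - e) ∘L contractL) ∘L fderiv ℝ Ω (y u))) = _
    module
  · exact Continuous.integrable_unitInterval
      ((alternatizeUncurryFinCLM ℝ E ℝ).continuous.comp hA)
  · exact Continuous.integrable_unitInterval (by fun_prop)

/-- In degree `0` the cone operator integrates the differential of a function along rays. -/
theorem coneForm_extDeriv_zero (e : E) {Ω : E → E [⋀^Fin 0]→L[ℝ] ℝ}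
    (hΩ : ContDiff ℝ (⊤ : ℕ∞) Ω) (x : E) : coneForm e (extDeriv Ω) x = Ω x - Ω e := by
  have hc' : Continuous (fderiv ℝ Ω) := hΩ.continuous_fderiv (by simp)
  have h2 : ∀ t : ℝ, HasDerivAt (fun t : ℝ => Ω (e + t • (x - e)))
      (fderiv ℝ Ω (e + t • (x - e)) (x - e)) t := by
    intro t
    have hy' : HasDerivAt (fun t : ℝ => e + t • (x - e)) (x - e) t := by
      simpa using ((hasDerivAt_id t).smul_const (x - e)).const_add e
    exact ((hΩ.differentiable (by simp) _).hasFDerivAt).comp_hasDerivAt t hy'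
  simp only [coneForm, coneIntegral, contractL_apply, extDeriv, pow_zero, one_smul,
    curryLeft_alternatizeUncurryFin_zero]
  rw [integral_unitInterval_eq_intervalIntegral
    (fun t : ℝ => fderiv ℝ Ω (e + t • (x - e)) (x - e)),
    intervalIntegral.integral_eq_sub_of_hasDerivAt (fun t _ => h2 t)
      (Continuous.intervalIntegrable (by fun_prop) _ _)]
  simp

end Poincare

end

/-! ### Barycentric coordinates of a regular simplex -/

section

variable {E : Type u} [NormedAddCommGroup E]

/-- Any two distinct points of `s` have distance `1`. -/
def UnitEdges (s : Finset E) : Prop := ∀ x ∈ s, ∀ y ∈ s, x ≠ y → dist x y = 1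

theorem UnitEdges.mono {s t : Finset E} (ht : UnitEdges t) (h : s ⊆ t) : UnitEdges s :=
  fun x hx y hy => ht x (h hx) y (h hy)

theorem UnitEdges.sq_dist [DecidableEq E] {s : Finset E} (hs : UnitEdges s) {v w : E} (hv : v ∈ s)
    (hw : w ∈ s) : ‖v - w‖ ^ 2 = 1 - if v = w then 1 else 0 := by
  split_ifs with h
  · simp [h]
  · simp [← dist_eq_norm, hs v hv w hw h]

variable [InnerProductSpace ℝ E]

theorem UnitEdges.dist_le {s : Finset E} (hs : UnitEdges s) {x y : E}
    (hx : x ∈ closedSimplex s) (hy : y ∈ closedSimplex s) : dist x y ≤ 1 := by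
  have hb : Bornology.IsBounded (closedSimplex s) :=
    isBounded_convexHull.2 s.finite_toSet.isBounded
  refine (Metric.dist_le_diam_of_mem hb hx hy).trans ?_
  rw [closedSimplex, convexHull_diam]
  refine Metric.diam_le_of_forall_dist_le zero_le_one fun a ha b hb => ?_
  by_cases h : a = b
  · simp [h]
  · exact (hs a ha b hb h).le

/-- The barycentre of the points of `s`. -/
def barycenter (s : Finset E) : E := (s.card : ℝ)⁻¹ • ∑ v ∈ s, v

theorem barycenter_mem {s : Finset E} (hs : s.Nonempty) : barycenter s ∈ closedSimplex s := by
  rw [barycenter, Finset.smul_sum]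
  refine (convex_convexHull ℝ _).sum_mem (fun _ _ => by positivity) ?_
    fun v hv => subset_convexHull ℝ _ hv
  have : (s.card : ℝ) ≠ 0 := by simpa using hs.ne_empty
  simp [this]

/-- For a regular simplex `s` with edges of length `1`, this is the differential of the barycentric
coordinate of the vertex `v`, extended to the ambient space by means of the orthogonal
projection. -/
def baryCovector (s : Finset E) (v : E) : E →L[ℝ] ℝ := (2 : ℝ) • innerSL ℝ (v - barycenter s)

theorem baryCovector_apply (s : Finset E) (v x : E) :
    baryCovector s v x = 2 * inner ℝ (v - barycenter s) x := rfl

/-- The barycentric coordinate of the vertex `v` of a regular simplex `s` with edges of length `1`,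
extended to the ambient space by means of the orthogonal projection. -/
def baryCoord (s : Finset E) (v x : E) : ℝ :=
  baryCovector s v (x - barycenter s) + (s.card : ℝ)⁻¹

theorem sum_sub_barycenter (s : Finset E) : ∑ v ∈ s, (v - barycenter s) = 0 := by
  rcases s.eq_empty_or_nonempty with rfl | hs
  · simp
  have : (s.card : ℝ) ≠ 0 := by simpa using hs.ne_empty
  rw [Finset.sum_sub_distrib, Finset.sum_const, barycenter, ← Nat.cast_smul_eq_nsmul ℝ, smul_smul,
    mul_inv_cancel₀ this, one_smul, sub_self]

theorem sum_baryCovector (s : Finset E) : ∑ v ∈ s, baryCovector s v = 0 := by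
  simp only [baryCovector, ← Finset.smul_sum, ← map_sum, sum_sub_barycenter, map_zero, smul_zero]

theorem sum_baryCoord {s : Finset E} (hs : s.Nonempty) (x : E) : ∑ v ∈ s, baryCoord s v x = 1 := by
  have : (s.card : ℝ) ≠ 0 := by simpa using hs.ne_empty
  have h := congrArg (fun f : E →L[ℝ] ℝ => f (x - barycenter s)) (sum_baryCovector s)
  simp only [sum_apply, zero_apply] at h
  simp only [baryCoord, Finset.sum_add_distrib, h]
  simp [this]

theorem UnitEdges.baryCovector_sub [DecidableEq E] {s : Finset E} (hs : UnitEdges s) {v w w' : E}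
    (hv : v ∈ s) (hw : w ∈ s) (hw' : w' ∈ s) :
    baryCovector s v (w - w') = (if v = w then 1 else 0) - if v = w' then 1 else 0 := by
  have hc : (s.card : ℝ) ≠ 0 := by simpa using Finset.ne_empty_of_mem hv
  have key : ∀ u, 2 * inner ℝ (v - u) (w - w') =
      (‖v - w'‖ ^ 2 - ‖v - w‖ ^ 2) + (‖u - w‖ ^ 2 - ‖u - w'‖ ^ 2) := by
    intro u
    simp only [norm_sub_sq_real, inner_sub_left, inner_sub_right]
    ring
  have h1 : v - barycenter s = (s.card : ℝ)⁻¹ • ∑ u ∈ s, (v - u) := by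
    rw [Finset.sum_sub_distrib, Finset.sum_const, smul_sub, ← Nat.cast_smul_eq_nsmul ℝ, smul_smul,
      inv_mul_cancel₀ hc, one_smul, barycenter]
  have h2 : ∀ w ∈ s, ∑ u ∈ s, ‖u - w‖ ^ 2 = s.card - 1 := by
    intro w hw
    rw [Finset.sum_congr rfl fun u hu => hs.sq_dist hu hw]
    simp [hw]
  have h3 : baryCovector s v (w - w') = (s.card : ℝ)⁻¹ *
      ∑ u ∈ s, 2 * inner ℝ (v - u) (w - w') := by
    rw [baryCovector_apply, h1, real_inner_smul_left, sum_inner, ← Finset.mul_sum]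
    ring
  rw [h3, Finset.sum_congr rfl fun u _ => key u, Finset.sum_add_distrib, Finset.sum_sub_distrib,
    Finset.sum_sub_distrib, h2 w hw, h2 w' hw', hs.sq_dist hv hw, hs.sq_dist hv hw']
  simp
  field_simp
  split_ifs <;> simp

theorem UnitEdges.baryCoord_vertex [DecidableEq E] {s : Finset E} (hs : UnitEdges s) {v w : E}
    (hv : v ∈ s) (hw : w ∈ s) : baryCoord s v w = if v = w then 1 else 0 := by
  have hc : (s.card : ℝ) ≠ 0 := by simpa using Finset.ne_empty_of_mem hv
  have h1 : w - barycenter s = (s.card : ℝ)⁻¹ • ∑ u ∈ s, (w - u) := by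
    rw [Finset.sum_sub_distrib, Finset.sum_const, smul_sub, ← Nat.cast_smul_eq_nsmul ℝ, smul_smul,
      inv_mul_cancel₀ hc, one_smul, barycenter]
  rw [baryCoord, h1, map_smul, map_sum,
    Finset.sum_congr rfl fun u hu => hs.baryCovector_sub hv hw hu]
  simp [hv]
  field_simp
  split_ifs <;> simp

theorem UnitEdges.norm_baryCovector_le {s : Finset E} (hs : UnitEdges s) {v : E} (hv : v ∈ s) :
    ‖baryCovector s v‖ ≤ 2 := by
  rw [baryCovector, norm_smul, innerSL_apply_norm, ← dist_eq_norm]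
  have := hs.dist_le (subset_convexHull ℝ _ hv) (barycenter_mem ⟨v, hv⟩)
  simp
  linarith

theorem UnitEdges.abs_baryCoord_le {s : Finset E} (hs : UnitEdges s) {v : E} (hv : v ∈ s) {x : E}
    (hx : x ∈ closedSimplex s) : |baryCoord s v x| ≤ 3 := by
  have h1 : |baryCovector s v (x - barycenter s)| ≤ 2 := by
    refine ((baryCovector s v).le_opNorm _).trans ?_
    have h2 := hs.dist_le hx (barycenter_mem ⟨v, hv⟩)
    rw [dist_eq_norm] at h2
    have := mul_le_mul (hs.norm_baryCovector_le hv) h2 (norm_nonneg _) zero_le_two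
    linarith
  have h3 : |((s.card : ℝ)⁻¹)| ≤ 1 := by
    rw [abs_of_nonneg (by positivity)]
    exact inv_le_one_of_one_le₀ (by exact_mod_cast Finset.card_pos.2 ⟨v, hv⟩)
  exact (abs_add_le _ _).trans (by linarith)

theorem continuous_baryCoord (s : Finset E) (v : E) : Continuous (baryCoord s v) := by
  unfold baryCoord; fun_prop

theorem contDiff_baryCoord (s : Finset E) (v : E) : ContDiff ℝ (⊤ : ℕ∞) (baryCoord s v) := by
  unfold baryCoord; fun_prop

theorem hasFDerivAt_baryCoord (s : Finset E) (v x : E) :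
    HasFDerivAt (baryCoord s v) (baryCovector s v) x :=
  ((baryCovector s v).hasFDerivAt.comp x ((hasFDerivAt_id x).sub_const _)).add_const _

/-- A barycentric coordinate of a simplex restricts to one on a face that contains the vertex. -/
theorem UnitEdges.baryCoord_face {s t : Finset E} (ht : UnitEdges t) (h : s ⊆ t) {v : E}
    (hv : v ∈ s) {x : E} (hx : x ∈ closedSimplex s) : baryCoord t v x = baryCoord s v x := by
  classical
  have hsub : (s : Set E) ⊆ {x | (baryCovector t v - baryCovector s v) x =
      baryCovector t v (barycenter t) - baryCovector s v (barycenter s)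
        - (t.card : ℝ)⁻¹ + (s.card : ℝ)⁻¹} := by
    intro w hw
    have h1 := ht.baryCoord_vertex (h hv) (h hw)
    have h2 := (ht.mono h).baryCoord_vertex hv hw
    simp only [baryCoord, map_sub] at h1 h2
    simp only [Set.mem_ofPred_eq, sub_apply]
    linarith
  have h3 := convexHull_min hsub
    (convex_hyperplane (baryCovector t v - baryCovector s v).toLinearMap.isLinear _) hx
  simp only [Set.mem_ofPred_eq, sub_apply] at h3
  simp only [baryCoord, map_sub]
  linarith

/-- A barycentric coordinate vanishes on the faces that do not contain the vertex. -/
theorem UnitEdges.baryCoord_face_of_notMem {s t : Finset E} (ht : UnitEdges t) (h : s ⊆ t) {v : E}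
    (hv : v ∈ t) (hvs : v ∉ s) {x : E} (hx : x ∈ closedSimplex s) : baryCoord t v x = 0 := by
  classical
  have hsub : (s : Set E) ⊆ {x | baryCovector t v x =
      baryCovector t v (barycenter t) - (t.card : ℝ)⁻¹} := by
    intro w hw
    have h1 := ht.baryCoord_vertex hv (h hw)
    rw [if_neg (by rintro rfl; exact hvs hw)] at h1
    simp only [baryCoord, map_sub] at h1
    simp only [Set.mem_ofPred_eq]
    linarith
  have h3 := convexHull_min hsub (convex_hyperplane (baryCovector t v).toLinearMap.isLinear _) hx
  simp only [Set.mem_ofPred_eq] at h3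
  simp only [baryCoord, map_sub]
  linarith

theorem UnitEdges.baryCovector_face {s t : Finset E} (ht : UnitEdges t) (h : s ⊆ t) {v : E}
    (hv : v ∈ s) : baryCovector t v ∘L SimplexTangent.toAmbient s =
      baryCovector s v ∘L SimplexTangent.toAmbient s := by
  classical
  have h1 : Set.EqOn (baryCovector t v).toLinearMap (baryCovector s v).toLinearMap
      ((s : Set E) -ᵥ (s : Set E)) := by
    rintro _ ⟨w, hw, w', hw', rfl⟩
    exact (ht.baryCovector_sub (h hv) (h hw) (h hw')).trans
      ((ht.mono h).baryCovector_sub hv hw hw').symm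
  refine ContinuousLinearMap.ext fun w => ?_
  exact LinearMap.eqOn_span (f := (baryCovector t v).toLinearMap)
    (g := (baryCovector s v).toLinearMap) h1 w.2

theorem UnitEdges.baryCovector_face_of_notMem {s t : Finset E} (ht : UnitEdges t) (h : s ⊆ t)
    {v : E} (hv : v ∈ t) (hvs : v ∉ s) :
    baryCovector t v ∘L SimplexTangent.toAmbient s = 0 := by
  classical
  have h1 : Set.EqOn (baryCovector t v).toLinearMap 0 ((s : Set E) -ᵥ (s : Set E)) := by
    rintro _ ⟨w, hw, w', hw', rfl⟩
    refine (ht.baryCovector_sub hv (h hw) (h hw')).trans ?_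
    rw [if_neg (by rintro rfl; exact hvs hw), if_neg (by rintro rfl; exact hvs hw')]
    exact sub_self _
  refine ContinuousLinearMap.ext fun w => ?_
  exact LinearMap.eqOn_span (f := (baryCovector t v).toLinearMap) (g := 0) h1 w.2

end

/-! ### Operators on the forms of a simplex -/

section

variable {E : Type u} [NormedAddCommGroup E] [InnerProductSpace ℝ E]

open ContinuousAlternatingMap

namespace SimplexForm

variable {s t : Finset E} {k l : ℕ}

theorem ext {α β : SimplexForm s k} (h : ∀ x, α x = β x) : α = β := ContinuousMap.ext h

theorem norm_le {α : SimplexForm s k} {C : ℝ} (hC : 0 ≤ C) (h : ∀ x, ‖α x‖ ≤ C) : ‖α‖ ≤ C :=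
  (ContinuousMap.norm_le _ hC).2 h

@[simp] theorem add_apply (α β : SimplexForm s k) (x : closedSimplex s) :
    (α + β) x = α x + β x := rfl

@[simp] theorem neg_apply (α : SimplexForm s k) (x : closedSimplex s) : (-α) x = -α x := rfl

@[simp] theorem sub_apply (α β : SimplexForm s k) (x : closedSimplex s) :
    (α - β) x = α x - β x := rfl

/-- Evaluation at a point. -/
def evalCLM (x : closedSimplex s) : SimplexForm s k →L[ℝ] SimplexTangent s [⋀^Fin k]→L[ℝ] ℝ :=
  ContinuousMap.evalCLM ℝ x

theorem sum_apply {ι : Type*} (I : Finset ι) (α : ι → SimplexForm s k) (x : closedSimplex s) :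
    (∑ i ∈ I, α i) x = ∑ i ∈ I, α i x :=
  map_sum (evalCLM x) α I

@[simp] theorem restrict_apply (h : s ⊆ t) (α : SimplexForm t k) (x : closedSimplex s) :
    restrict h k α x = (α ⟨x, convexHull_mono (Finset.coe_subset.2 h) x.2⟩).compContinuousLinearMap
      (SimplexTangent.inclusion h) := rfl

/-- The operator that acts at each point `x` by the linear map `M x` of norm at most `C`. -/
def pointwise (M : closedSimplex s → SimplexTangent s [⋀^Fin k]→L[ℝ] ℝ →L[ℝ]
    SimplexTangent s [⋀^Fin l]→L[ℝ] ℝ) (hM : Continuous M) (C : ℝ) (hC : ∀ x, ‖M x‖ ≤ C) :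
    SimplexForm s k →L[ℝ] SimplexForm s l :=
  LinearMap.mkContinuous
    { toFun := fun α => ContinuousMap.mk (fun x => M x (α x)) (hM.clm_apply α.continuous)
      map_add' := fun α β => ext fun x => _root_.map_add (M x) (α x) (β x)
      map_smul' := fun c α => ext fun x => _root_.map_smul (M x) c (α x) }
    C (fun α => by
      by_cases h : Nonempty (closedSimplex s)
      · obtain ⟨y⟩ := h
        have hC0 : 0 ≤ C := (ContinuousLinearMap.opNorm_nonneg (M y)).trans (hC y)
        exact norm_le (by positivity) fun x => ((M x).le_opNorm _).trans
          (mul_le_mul (hC x) (α.norm_apply_le x) (norm_nonneg _) hC0)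
      · have : α = 0 := ext fun x => (h ⟨x⟩).elim
        simp [this])

theorem norm_pointwise_le (M : closedSimplex s → SimplexTangent s [⋀^Fin k]→L[ℝ] ℝ →L[ℝ]
    SimplexTangent s [⋀^Fin l]→L[ℝ] ℝ) (hM : Continuous M) (C : ℝ) (hC : ∀ x, ‖M x‖ ≤ C)
    (hC0 : 0 ≤ C) : ‖pointwise M hM C hC‖ ≤ C :=
  LinearMap.mkContinuous_norm_le _ hC0 _

/-- Exterior multiplication by the differential of the barycentric coordinate of `v`. -/
def wedge (v : E) : SimplexForm s k →L[ℝ] SimplexForm s (k + 1) :=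
  pointwise (fun _ => wedgeCovector (baryCovector s v ∘L SimplexTangent.toAmbient s))
    continuous_const _ fun _ => le_rfl

@[simp] theorem wedge_apply (v : E) (α : SimplexForm s k) (x : closedSimplex s) :
    wedge v α x = wedgeCovector (baryCovector s v ∘L SimplexTangent.toAmbient s) (α x) := rfl

/-- The barycentric coordinate of `v` as a continuous function on the simplex. -/
def baryFunction (s : Finset E) (v : E) : C(closedSimplex s, ℝ) :=
  ⟨fun x => baryCoord s v x, (continuous_baryCoord s v).comp continuous_subtype_val⟩

/-- Multiplication by the barycentric coordinate of `v`. -/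
def mulBary (v : E) : SimplexForm s k →L[ℝ] SimplexForm s k :=
  pointwise (fun x => baryCoord s v x • ContinuousLinearMap.id ℝ _)
    ((baryFunction s v).continuous.smul continuous_const) ‖baryFunction s v‖ fun x => by
      refine ContinuousLinearMap.opNorm_le_bound _ (norm_nonneg _) fun a => ?_
      refine (norm_smul_le (baryCoord s v x) a).trans ?_
      exact mul_le_mul_of_nonneg_right ((baryFunction s v).norm_coe_le_norm x) (norm_nonneg _)

@[simp] theorem mulBary_apply (v : E) (α : SimplexForm s k) (x : closedSimplex s) :
    mulBary v α x = baryCoord s v x • α x := rfl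

/-- The point at the parameter `u` of the segment from the vertex `v` to the point `x`. -/
def segmentPoint (v : s) (x : closedSimplex s) (u : unitInterval) : closedSimplex s :=
  ⟨(v : E) + (u : ℝ) • ((x : E) - v), (convex_convexHull ℝ _).add_smul_sub_mem
    (subset_convexHull ℝ _ v.2) x.2 u.2⟩

/-- The vector from the vertex `v` to the point `x`. -/
def rayVector (v : s) (x : closedSimplex s) : SimplexTangent s :=
  ⟨(x : E) - v, by
    rw [← direction_affineSpan]
    exact AffineSubspace.vsub_mem_direction (convexHull_subset_affineSpan _ x.2)
      (subset_affineSpan ℝ _ v.2)⟩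

theorem continuous_segmentPoint (v : s) :
    Continuous fun p : closedSimplex s × unitInterval => segmentPoint v p.1 p.2 :=
  Continuous.subtype_mk (by fun_prop) _

theorem continuous_rayVector (v : s) : Continuous (rayVector v : closedSimplex s → _) :=
  Continuous.subtype_mk (by fun_prop) _

theorem continuous_comp_segmentPoint (α : SimplexForm s k) (v : s) (x : closedSimplex s) :
    Continuous fun u => α (segmentPoint v x u) :=
  α.continuous.comp ((continuous_segmentPoint v).comp (Continuous.prodMk_right x))

theorem norm_rayVector_le (v : s) (x : closedSimplex s) :
    ‖rayVector v x‖ ≤ Metric.diam (closedSimplex s) := by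
  change ‖(x : E) - v‖ ≤ _
  rw [← dist_eq_norm]
  exact Metric.dist_le_diam_of_mem (isBounded_convexHull.2 s.finite_toSet.isBounded) x.2
    (subset_convexHull ℝ _ v.2)

/-- The cone operator of a simplex with apex the vertex `v`. -/
def cone (v : s) : SimplexForm s (k + 1) →L[ℝ] SimplexForm s k :=
  LinearMap.mkContinuous
    { toFun := fun α => ContinuousMap.mk
        (fun x => coneIntegral (fun u => α (segmentPoint v x u)) (rayVector v x)) (by
          have h1 : Continuous fun p : closedSimplex s × unitInterval =>
              α (segmentPoint v p.1 p.2) := α.continuous.comp (continuous_segmentPoint v)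
          have h2 := continuous_rayVector v
          have h3 : Continuous fun p : closedSimplex s × unitInterval =>
              (p.2 : ℝ) ^ k • contractL (α (segmentPoint v p.1 p.2)) (rayVector v p.1) :=
            ((continuous_subtype_val.comp continuous_snd).pow k).smul
              ((contractL.continuous.comp h1).clm_apply (h2.comp continuous_fst))
          have h4 := continuous_parametric_integral_of_continuous
            (μ := (MeasureTheory.volume : MeasureTheory.Measure unitInterval))
            (f := fun (x : closedSimplex s) (u : unitInterval) =>
              (u : ℝ) ^ k • contractL (α (segmentPoint v x u)) (rayVector v x)) h3 isCompact_univ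
          rw [MeasureTheory.Measure.restrict_univ] at h4
          exact h4)
      map_add' := fun α β => ext fun x => coneIntegral_add (α.continuous_comp_segmentPoint v x)
        (β.continuous_comp_segmentPoint v x) _
      map_smul' := fun c α => ext fun x => coneIntegral_smul c _ _ }
    (Metric.diam (closedSimplex s)) (fun α => norm_le
      (mul_nonneg Metric.diam_nonneg (norm_nonneg _)) fun x =>
      (norm_coneIntegral_le (fun u => α.norm_apply_le _) _).trans <| by
        rw [mul_comm]
        exact mul_le_mul_of_nonneg_right (norm_rayVector_le v x) (norm_nonneg _))

theorem cone_apply (v : s) (α : SimplexForm s (k + 1)) (x : closedSimplex s) :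
    cone v α x = coneIntegral (fun u => α (segmentPoint v x u)) (rayVector v x) := rfl

end SimplexForm

/-! ### Norms of the operators on a regular simplex -/

namespace UnitEdges

variable {s : Finset E} {k : ℕ}

theorem norm_cone_le (hs : UnitEdges s) (v : s) :
    ‖SimplexForm.cone (k := k) v‖ ≤ 1 :=
  (LinearMap.mkContinuous_norm_le _ Metric.diam_nonneg _).trans
    (Metric.diam_le_of_forall_dist_le zero_le_one fun _ hx _ hy => hs.dist_le hx hy)

theorem norm_wedge_le (hs : UnitEdges s) (v : s) :
    ‖SimplexForm.wedge (s := s) (k := k) (v : E)‖ ≤ (k + 1) * 2 := by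
  refine (SimplexForm.norm_pointwise_le _ _ _ _ (ContinuousLinearMap.opNorm_nonneg
    (wedgeCovector (baryCovector s v ∘L SimplexTangent.toAmbient s)))).trans ?_
  refine (norm_wedgeCovector_le _).trans (mul_le_mul_of_nonneg_left ?_ (by positivity))
  refine ContinuousLinearMap.opNorm_le_bound _ zero_le_two fun w => ?_
  exact (ContinuousLinearMap.le_opNorm (baryCovector s v) _).trans
    (mul_le_mul_of_nonneg_right (hs.norm_baryCovector_le v.2) (norm_nonneg _))

theorem norm_mulBary_le (hs : UnitEdges s) (v : s) :
    ‖SimplexForm.mulBary (s := s) (k := k) (v : E)‖ ≤ 3 :=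
  (SimplexForm.norm_pointwise_le _ _ _ _ (norm_nonneg _)).trans
    ((ContinuousMap.norm_le _ (by norm_num)).2 fun x => hs.abs_baryCoord_le v.2 x.2)

end UnitEdges

/-! ### Restriction to faces -/

namespace SimplexForm

variable {s t : Finset E} {k : ℕ}

theorem restrict_cone (h : s ⊆ t) (v : s) (α : SimplexForm t (k + 1)) :
    restrict h k (cone (⟨v, h v.2⟩ : t) α) = cone v (restrict h (k + 1) α) :=
  ext fun x => coneIntegral_compContinuousLinearMap
    (α.continuous_comp_segmentPoint (⟨v, h v.2⟩ : t) _) (SimplexTangent.inclusion h) (rayVector v x)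

theorem restrict_wedge (ht : UnitEdges t) (h : s ⊆ t) {v : E} (hv : v ∈ s) (α : SimplexForm t k) :
    restrict h (k + 1) (wedge v α) = wedge v (restrict h k α) := by
  refine ext fun x => ?_
  rw [restrict_apply, wedge_apply, wedgeCovector_compContinuousLinearMap, wedge_apply,
    ← ht.baryCovector_face h hv]
  rfl

theorem restrict_wedge_of_notMem (ht : UnitEdges t) (h : s ⊆ t) {v : E} (hv : v ∈ t)
    (hvs : v ∉ s) (α : SimplexForm t k) : restrict h (k + 1) (wedge v α) = 0 := by
  refine ext fun x => ?_
  rw [restrict_apply, wedge_apply, wedgeCovector_compContinuousLinearMap]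
  change wedgeCovector (baryCovector t v ∘L SimplexTangent.toAmbient s) _ = 0
  rw [ht.baryCovector_face_of_notMem h hv hvs, wedgeCovector_zero]
  rfl

theorem restrict_mulBary (ht : UnitEdges t) (h : s ⊆ t) {v : E} (hv : v ∈ s)
    (α : SimplexForm t k) : restrict h k (mulBary v α) = mulBary v (restrict h k α) := by
  refine ext fun x => ?_
  rw [restrict_apply, mulBary_apply, mulBary_apply, ← ht.baryCoord_face h hv x.2]
  rfl

theorem restrict_mulBary_of_notMem (ht : UnitEdges t) (h : s ⊆ t) {v : E} (hv : v ∈ t)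
    (hvs : v ∉ s) (α : SimplexForm t k) : restrict h k (mulBary v α) = 0 := by
  refine ext fun x => ?_
  rw [restrict_apply, mulBary_apply, ht.baryCoord_face_of_notMem h hv hvs x.2, zero_smul]
  rfl

/-! ### Smooth forms and their exterior derivatives -/

theorem IsRestriction.cone {Ω : E → E [⋀^Fin (k + 1)]→L[ℝ] ℝ} {α : SimplexForm s (k + 1)}
    (h : α.IsRestriction Ω) (hΩ : Continuous Ω) (v : s) :
    (SimplexForm.cone v α).IsRestriction (coneForm (v : E) Ω) := by
  intro x
  have h1 : Continuous fun u : unitInterval => Ω ((v : E) + (u : ℝ) • ((x : E) - v)) := by fun_prop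
  refine Eq.trans ?_ (coneIntegral_compContinuousLinearMap h1 (SimplexTangent.toAmbient s)
    (rayVector v x)).symm
  rw [cone_apply]
  congr 1
  exact funext fun u => h _

theorem IsSmoothWithDeriv.cone {α : SimplexForm s (k + 1)} {η : SimplexForm s (k + 2)}
    (h : α.IsSmoothWithDeriv η) (v : s) :
    (SimplexForm.cone v α).IsSmoothWithDeriv (α - SimplexForm.cone v η) := by
  obtain ⟨Ω, hΩ, hα, hη⟩ := h
  have hd : Continuous (extDeriv Ω) := (alternatizeUncurryFinCLM ℝ E ℝ).continuous.comp
    (hΩ.continuous_fderiv (by simp))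
  refine ⟨coneForm (v : E) Ω, contDiff_coneForm _ hΩ, hα.cone hΩ.continuous v, fun x => ?_⟩
  rw [extDeriv_coneForm _ hΩ, sub_apply, hα x, hη.cone hd v x]
  rfl

theorem IsSmoothWithDeriv.cone_zero {α : SimplexForm s 0} {η : SimplexForm s 1}
    (h : α.IsSmoothWithDeriv η) (v : s) (x : closedSimplex s) :
    SimplexForm.cone v η x = α x - α ⟨v, subset_convexHull ℝ _ v.2⟩ := by
  obtain ⟨Ω, hΩ, hα, hη⟩ := h
  have hd : Continuous (extDeriv Ω) := (alternatizeUncurryFinCLM ℝ E ℝ).continuous.comp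
    (hΩ.continuous_fderiv (by simp))
  rw [hη.cone hd v x, coneForm_extDeriv_zero _ hΩ, hα x, hα]
  rfl

theorem IsSmoothWithDeriv.zero : (0 : SimplexForm s k).IsSmoothWithDeriv 0 := by
  refine ⟨fun _ => 0, contDiff_const, fun x => rfl, fun x => ?_⟩
  have h : extDeriv (fun _ : E => (0 : E [⋀^Fin k]→L[ℝ] ℝ)) (x : E) = 0 := by
    rw [extDeriv, fderiv_fun_const]
    exact _root_.map_zero (alternatizeUncurryFinCLM ℝ E ℝ)
  rw [h]
  rfl

theorem IsSmoothWithDeriv.add {α β : SimplexForm s k} {η ζ : SimplexForm s (k + 1)}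
    (h : α.IsSmoothWithDeriv η) (h' : β.IsSmoothWithDeriv ζ) :
    (α + β).IsSmoothWithDeriv (η + ζ) := by
  obtain ⟨A, hA, hA1, hA2⟩ := h
  obtain ⟨B, hB, hB1, hB2⟩ := h'
  refine ⟨A + B, hA.add hB, fun x => ?_, fun x => ?_⟩
  · rw [add_apply, hA1, hB1]; rfl
  · rw [add_apply, hA2, hB2, extDeriv_add ((hA.differentiable (by simp)) _)
      ((hB.differentiable (by simp)) _)]; rfl

theorem IsSmoothWithDeriv.neg {α : SimplexForm s k} {η : SimplexForm s (k + 1)}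
    (h : α.IsSmoothWithDeriv η) : (-α).IsSmoothWithDeriv (-η) := by
  obtain ⟨A, hA, hA1, hA2⟩ := h
  refine ⟨(-1 : ℝ) • A, contDiff_const.smul hA, fun x => ?_, fun x => ?_⟩
  · rw [neg_apply, hA1, ← neg_one_smul ℝ]; rfl
  · rw [neg_apply, hA2, extDeriv_smul, ← neg_one_smul ℝ]; rfl

theorem IsSmoothWithDeriv.sub {α β : SimplexForm s k} {η ζ : SimplexForm s (k + 1)}
    (h : α.IsSmoothWithDeriv η) (h' : β.IsSmoothWithDeriv ζ) :
    (α - β).IsSmoothWithDeriv (η - ζ) := by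
  rw [sub_eq_add_neg, sub_eq_add_neg]
  exact h.add h'.neg

theorem IsSmoothWithDeriv.sum {ι : Type*} (I : Finset ι) {α : ι → SimplexForm s k}
    {η : ι → SimplexForm s (k + 1)} (h : ∀ i ∈ I, (α i).IsSmoothWithDeriv (η i)) :
    (∑ i ∈ I, α i).IsSmoothWithDeriv (∑ i ∈ I, η i) := by
  classical
  induction I using Finset.induction_on with
  | empty => simpa using IsSmoothWithDeriv.zero
  | insert i I hi ih =>
    rw [Finset.sum_insert hi, Finset.sum_insert hi]
    exact (h i (Finset.mem_insert_self i I)).add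
      (ih fun j hj => h j (Finset.mem_insert_of_mem hj))

theorem IsSmoothWithDeriv.wedge {α : SimplexForm s k} {η : SimplexForm s (k + 1)}
    (h : α.IsSmoothWithDeriv η) (v : E) :
    (SimplexForm.wedge v α).IsSmoothWithDeriv (-SimplexForm.wedge v η) := by
  obtain ⟨Ω, hΩ, hα, hη⟩ := h
  refine ⟨fun x => wedgeCovector (baryCovector s v) (Ω x),
    (wedgeCovector (k := k) (baryCovector s v)).contDiff.comp hΩ, fun x => ?_, fun x => ?_⟩
  · rw [wedgeCovector_compContinuousLinearMap, wedge_apply, hα]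
  · have h1 : fderiv ℝ (fun x => wedgeCovector (baryCovector s v) (Ω x)) (x : E) =
        wedgeCovector (baryCovector s v) ∘L fderiv ℝ Ω x :=
      ((wedgeCovector (k := k) (baryCovector s v)).hasFDerivAt.comp (x : E)
        (hΩ.differentiable (by simp) (x : E)).hasFDerivAt).fderiv
    rw [extDeriv, h1, alternatizeUncurryFin_wedgeCovector_comp, neg_apply, wedge_apply, hη,
      ← wedgeCovector_compContinuousLinearMap]
    rfl

theorem IsSmoothWithDeriv.mulBary {α : SimplexForm s k} {η : SimplexForm s (k + 1)}
    (h : α.IsSmoothWithDeriv η) (v : E) :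
    (SimplexForm.mulBary v α).IsSmoothWithDeriv
      (SimplexForm.wedge v α + SimplexForm.mulBary v η) := by
  obtain ⟨Ω, hΩ, hα, hη⟩ := h
  refine ⟨fun x => baryCoord s v x • Ω x, (contDiff_baryCoord s v).smul hΩ,
    fun x => ?_, fun x => ?_⟩
  · rw [mulBary_apply, hα]; rfl
  · have h1 : fderiv ℝ (fun x => baryCoord s v x • Ω x) (x : E) =
        baryCoord s v x • fderiv ℝ Ω x + (baryCovector s v).smulRight (Ω x) :=
      ((hasFDerivAt_baryCoord s v x).smul
        (hΩ.differentiable (by simp) (x : E)).hasFDerivAt).fderiv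
    rw [extDeriv, h1, alternatizeUncurryFin_add, alternatizeUncurryFin_smul, ← wedgeCovector_def,
      add_apply, wedge_apply, mulBary_apply, hα, hη, ← wedgeCovector_compContinuousLinearMap]
    exact add_comm _ _

end SimplexForm

end

/-! ### The contracting homotopy on a simplex -/

section

variable {E : Type u} [NormedAddCommGroup E] [InnerProductSpace ℝ E]

/-- A sum over `t` of terms that vanish outside `s ⊆ t` is a sum over `s`. -/
theorem Finset.sum_coe_of_subset {V X : Type*} [AddCommMonoid X] {s t : Finset V}
    (h : s ⊆ t) (f : s → X) (g : t → X)
    (h0 : ∀ v : t, (v : V) ∉ s → g v = 0) (h1 : ∀ v : s, g ⟨v, h v.2⟩ = f v) :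
    ∑ v, g v = ∑ v, f v := by
  refine (Fintype.sum_of_injective (fun v : s => (⟨v, h v.2⟩ : t)) (fun v w hvw => ?_) f g
    (fun v hv => h0 v fun hvs => hv ⟨⟨v, hvs⟩, rfl⟩) fun v => (h1 v).symm).symm
  exact Subtype.ext (congrArg (fun z : t => (z : V)) hvw)

namespace SimplexForm

variable {s t : Finset E} {k : ℕ}

/-- The constant function with the value of a function at the vertex `v`. -/
def constAt (v : s) : SimplexForm s 0 →L[ℝ] SimplexForm s 0 :=
  LinearMap.mkContinuous
    { toFun := fun α => ContinuousMap.const _ (α ⟨v, subset_convexHull ℝ _ v.2⟩)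
      map_add' := fun _ _ => rfl
      map_smul' := fun _ _ => rfl }
    1 (fun α => by rw [one_mul]; exact norm_le (norm_nonneg _) fun x => α.norm_apply_le _)

theorem norm_constAt_le (v : s) : ‖constAt v‖ ≤ 1 :=
  LinearMap.mkContinuous_norm_le _ zero_le_one _

/-- The operator `R = ∑_p (-1)^p ∑ dt_{i₁} ∧ ⋯ ∧ dt_{i_p} ∧ h_{i_p} ⋯ h_{i₁}`, where `h_i` is the
cone operator with apex the vertex `i` and `t_i` is a barycentric coordinate. -/
def residual : ∀ k, SimplexForm s k →L[ℝ] SimplexForm s k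
  | 0 => ContinuousLinearMap.id ℝ _
  | k + 1 => ContinuousLinearMap.id ℝ _ - ∑ v : s, wedge (v : E) ∘L residual k ∘L cone v

/-- The commutator `R d - d R` of the operator `R` with the exterior derivative.  It is an iterated
cone, so that it only depends on the integrals of a form over the faces. -/
def residualComm : ∀ k, SimplexForm s k →L[ℝ] SimplexForm s (k + 1)
  | 0 => ∑ v : s, wedge (v : E) ∘L constAt v
  | k + 1 => ∑ v : s, wedge (v : E) ∘L residualComm k ∘L cone v

/-- Dupont's homotopy operator `∑_i t_i R h_i`. -/
def dupont (k : ℕ) : SimplexForm s (k + 1) →L[ℝ] SimplexForm s k :=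
  ∑ v : s, mulBary (v : E) ∘L residual k ∘L cone v

/-- The composition of the integration over the faces with the Whitney forms of these faces,
expressed by iterated cones. -/
def whitney : ∀ k, SimplexForm s k →L[ℝ] SimplexForm s k
  | 0 => ∑ v : s, mulBary (v : E) ∘L constAt v
  | k + 1 => ∑ v : s, mulBary (v : E) ∘L residualComm k ∘L cone v

theorem residual_zero (α : SimplexForm s 0) : residual 0 α = α := rfl

theorem residual_succ (α : SimplexForm s (k + 1)) :
    residual (k + 1) α = α - ∑ v : s, wedge (v : E) (residual k (cone v α)) := by
  simp [residual]

theorem residualComm_zero (α : SimplexForm s 0) :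
    residualComm 0 α = ∑ v : s, wedge (v : E) (constAt v α) := by
  simp [residualComm]

theorem residualComm_succ (α : SimplexForm s (k + 1)) :
    residualComm (k + 1) α = ∑ v : s, wedge (v : E) (residualComm k (cone v α)) := by
  simp [residualComm]

theorem dupont_apply (α : SimplexForm s (k + 1)) :
    dupont k α = ∑ v : s, mulBary (v : E) (residual k (cone v α)) := by
  simp [dupont]

theorem whitney_zero (α : SimplexForm s 0) :
    whitney 0 α = ∑ v : s, mulBary (v : E) (constAt v α) := by
  simp [whitney]

theorem whitney_succ (α : SimplexForm s (k + 1)) :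
    whitney (k + 1) α = ∑ v : s, mulBary (v : E) (residualComm k (cone v α)) := by
  simp [whitney]

/-- The differentials of the barycentric coordinates add up to zero. -/
theorem sum_wedge (α : SimplexForm s k) : ∑ v : s, wedge (v : E) α = 0 := by
  refine ext fun x => ?_
  rw [sum_apply]
  simp only [wedge_apply]
  rw [ContinuousAlternatingMap.wedgeCovector_sum]
  have h : ∑ v : s, baryCovector s v ∘L SimplexTangent.toAmbient s = 0 := by
    refine ContinuousLinearMap.ext fun w => ?_
    have h1 := congrArg (fun f : E →L[ℝ] ℝ => f (SimplexTangent.toAmbient s w))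
      (sum_baryCovector s)
    rw [← Finset.sum_coe_sort] at h1
    simpa using h1
  rw [h, ContinuousAlternatingMap.wedgeCovector_zero]
  rfl

theorem sum_mulBary (α : SimplexForm s k) : ∑ v : s, mulBary (v : E) α = α := by
  refine ext fun x => ?_
  have hs : s.Nonempty := by
    have := convexHull_nonempty_iff.1 ⟨_, x.2⟩
    exact_mod_cast this
  rw [sum_apply]
  simp only [mulBary_apply]
  rw [← Finset.sum_smul, Finset.sum_coe_sort s fun v => baryCoord s v x, sum_baryCoord hs,
    one_smul]

theorem IsSmoothWithDeriv.cone_eq {α : SimplexForm s 0} {η : SimplexForm s 1}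
    (h : α.IsSmoothWithDeriv η) (v : s) : SimplexForm.cone v η = α - constAt v α :=
  ext fun x => h.cone_zero v x

/-- If `η = dα`, then `d R α = R η - R' α`, where `R'` is the operator `residualComm`; this
identifies `R'` with the commutator `R d - d R`. -/
theorem IsSmoothWithDeriv.residual {α : SimplexForm s k} {η : SimplexForm s (k + 1)}
    (h : α.IsSmoothWithDeriv η) :
    (SimplexForm.residual k α).IsSmoothWithDeriv
      (SimplexForm.residual (k + 1) η - residualComm k α) := by
  induction k with
  | zero =>
    have h1 : SimplexForm.residual 1 η - residualComm 0 α = η := by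
      rw [residual_succ, residualComm_zero, sub_sub, ← Finset.sum_add_distrib]
      simp only [residual_zero, h.cone_eq, ← map_add, sub_add_cancel, sum_wedge, sub_zero]
    rw [h1]
    exact h
  | succ k ih =>
    have h1 := h.sub (IsSmoothWithDeriv.sum Finset.univ fun (v : s) _ =>
      (ih (h.cone v)).wedge (v : E))
    rw [← residual_succ] at h1
    convert! h1 using 1
    simp only [map_sub, neg_sub, Finset.sum_sub_distrib, sum_wedge]
    rw [residual_succ η, residualComm_succ]
    abel

/-- The homotopy formula `d S + S d = 1 - W` in positive degrees. -/
theorem IsSmoothWithDeriv.dupont {α : SimplexForm s (k + 1)} {η : SimplexForm s (k + 2)}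
    (h : α.IsSmoothWithDeriv η) :
    (SimplexForm.dupont k α).IsSmoothWithDeriv
      (α - SimplexForm.dupont (k + 1) η - whitney (k + 1) α) := by
  have h1 := IsSmoothWithDeriv.sum Finset.univ fun (v : s) _ => (h.cone v).residual.mulBary (v : E)
  rw [← dupont_apply] at h1
  convert! h1 using 1
  simp only [map_sub, Finset.sum_add_distrib, Finset.sum_sub_distrib, sum_mulBary]
  rw [residual_succ α, whitney_succ, dupont_apply]
  abel

/-! ### Naturality of the homotopy -/

theorem restrict_constAt (h : s ⊆ t) (v : s) (α : SimplexForm t 0) :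
    restrict h 0 (constAt (⟨v, h v.2⟩ : t) α) = constAt v (restrict h 0 α) := rfl

theorem restrict_residual (ht : UnitEdges t) (h : s ⊆ t) (α : SimplexForm t k) :
    restrict h k (residual k α) = residual k (restrict h k α) := by
  induction k with
  | zero => rfl
  | succ k ih =>
    rw [residual_succ, residual_succ, map_sub, map_sum]
    congr 1
    refine Finset.sum_coe_of_subset h _ _
      (fun v hv => restrict_wedge_of_notMem ht h v.2 hv _) fun v => ?_
    rw [restrict_wedge ht h v.2, ih, restrict_cone]

theorem restrict_residualComm (ht : UnitEdges t) (h : s ⊆ t) (α : SimplexForm t k) :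
    restrict h (k + 1) (residualComm k α) = residualComm k (restrict h k α) := by
  induction k with
  | zero =>
    rw [residualComm_zero, residualComm_zero, map_sum]
    refine Finset.sum_coe_of_subset h _ _
      (fun v hv => restrict_wedge_of_notMem ht h v.2 hv _) fun v => ?_
    rw [restrict_wedge ht h v.2, restrict_constAt]
  | succ k ih =>
    rw [residualComm_succ, residualComm_succ, map_sum]
    refine Finset.sum_coe_of_subset h _ _
      (fun v hv => restrict_wedge_of_notMem ht h v.2 hv _) fun v => ?_
    rw [restrict_wedge ht h v.2, ih, restrict_cone]

theorem restrict_dupont (ht : UnitEdges t) (h : s ⊆ t) (α : SimplexForm t (k + 1)) :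
    restrict h k (dupont k α) = dupont k (restrict h (k + 1) α) := by
  rw [dupont_apply, dupont_apply, map_sum]
  refine Finset.sum_coe_of_subset h _ _
    (fun v hv => restrict_mulBary_of_notMem ht h v.2 hv _) fun v => ?_
  rw [restrict_mulBary ht h v.2, restrict_residual ht, restrict_cone]

theorem restrict_whitney (ht : UnitEdges t) (h : s ⊆ t) (α : SimplexForm t k) :
    restrict h k (whitney k α) = whitney k (restrict h k α) := by
  cases k with
  | zero =>
    rw [whitney_zero, whitney_zero, map_sum]
    refine Finset.sum_coe_of_subset h _ _
      (fun v hv => restrict_mulBary_of_notMem ht h v.2 hv _) fun v => ?_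
    rw [restrict_mulBary ht h v.2, restrict_constAt]
  | succ k =>
    rw [whitney_succ, whitney_succ, map_sum]
    refine Finset.sum_coe_of_subset h _ _
      (fun v hv => restrict_mulBary_of_notMem ht h v.2 hv _) fun v => ?_
    rw [restrict_mulBary ht h v.2, restrict_residualComm ht, restrict_cone]

/-! ### Uniform bounds for the homotopy -/

theorem norm_sum_comp_le {X Y Z W : Type*} [NormedAddCommGroup X] [NormedSpace ℝ X]
    [NormedAddCommGroup Y] [NormedSpace ℝ Y] [NormedAddCommGroup Z] [NormedSpace ℝ Z]
    [NormedAddCommGroup W] [NormedSpace ℝ W] {ι : Type*} [Fintype ι] {A : ι → Z →L[ℝ] W}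
    {B : Y →L[ℝ] Z} {C : ι → X →L[ℝ] Y} {a b : ℝ} (ha0 : 0 ≤ a) (hA : ∀ i, ‖A i‖ ≤ a)
    (hB : ‖B‖ ≤ b) (hC : ∀ i, ‖C i‖ ≤ 1) : ‖∑ i, A i ∘L B ∘L C i‖ ≤ Fintype.card ι * (a * b) := by
  have hb : 0 ≤ b := (norm_nonneg _).trans hB
  refine (norm_sum_le_of_le (f := fun i => A i ∘L B ∘L C i) _ fun i _ => ?_).trans
    (by simp : ∑ _i : ι, a * b ≤ _)
  refine (ContinuousLinearMap.opNorm_comp_le _ _).trans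
    (mul_le_mul (hA i) ?_ (norm_nonneg _) ha0)
  refine (ContinuousLinearMap.opNorm_comp_le _ _).trans ?_
  exact (mul_le_mul hB (hC i) (norm_nonneg _) hb).trans (mul_one b).le

theorem exists_norm_residual_le (N k : ℕ) : ∃ C : ℝ, ∀ s : Finset E, UnitEdges s → s.card = N →
    ‖residual (s := s) k‖ ≤ C := by
  induction k with
  | zero => exact ⟨1, fun s _ _ => ContinuousLinearMap.norm_id_le⟩
  | succ k ih =>
    obtain ⟨C, hC⟩ := ih
    refine ⟨1 + N * ((k + 1) * 2 * C), fun s hs hN => ?_⟩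
    refine (norm_sub_le _ _).trans (add_le_add ContinuousLinearMap.norm_id_le ?_)
    refine (norm_sum_comp_le (by positivity) hs.norm_wedge_le (hC s hs hN) hs.norm_cone_le).trans ?_
    simp [hN]

theorem exists_norm_residualComm_le (N k : ℕ) : ∃ C : ℝ, ∀ s : Finset E, UnitEdges s →
    s.card = N → ‖residualComm (s := s) k‖ ≤ C := by
  induction k with
  | zero =>
    refine ⟨N * (((0 : ℕ) + 1) * 2 * 1), fun s hs hN => ?_⟩
    have := norm_sum_comp_le (B := ContinuousLinearMap.id ℝ (SimplexForm s 0)) (by positivity)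
      (hs.norm_wedge_le (k := 0)) ContinuousLinearMap.norm_id_le (norm_constAt_le (s := s))
    rw [Fintype.card_coe, hN] at this
    exact this
  | succ k ih =>
    obtain ⟨C, hC⟩ := ih
    refine ⟨N * (((k + 1 : ℕ) + 1) * 2 * C), fun s hs hN => ?_⟩
    refine (norm_sum_comp_le (by positivity) hs.norm_wedge_le (hC s hs hN) hs.norm_cone_le).trans ?_
    simp [hN]

theorem exists_norm_dupont_le (N k : ℕ) : ∃ C : ℝ, ∀ s : Finset E, UnitEdges s → s.card = N →
    ‖dupont (s := s) k‖ ≤ C := by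
  obtain ⟨C, hC⟩ := exists_norm_residual_le (E := E) N k
  refine ⟨N * (3 * C), fun s hs hN => ?_⟩
  refine (norm_sum_comp_le (by positivity) hs.norm_mulBary_le (hC s hs hN) hs.norm_cone_le).trans ?_
  simp [hN]

theorem exists_norm_whitney_le (N k : ℕ) : ∃ C : ℝ, ∀ s : Finset E, UnitEdges s → s.card = N →
    ‖whitney (s := s) k‖ ≤ C := by
  cases k with
  | zero =>
    refine ⟨N * (3 * 1), fun s hs hN => ?_⟩
    have := norm_sum_comp_le (B := ContinuousLinearMap.id ℝ (SimplexForm s 0)) (by positivity)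
      (hs.norm_mulBary_le (k := 0)) ContinuousLinearMap.norm_id_le (norm_constAt_le (s := s))
    rw [Fintype.card_coe, hN] at this
    exact this
  | succ k =>
    obtain ⟨C, hC⟩ := exists_norm_residualComm_le (E := E) N k
    refine ⟨N * (3 * C), fun s hs hN => ?_⟩
    refine (norm_sum_comp_le (by positivity) hs.norm_mulBary_le (hC s hs hN)
      hs.norm_cone_le).trans ?_
    simp [hN]

end SimplexForm

end

/-! ### Integration over the standard simplex by slices -/

section

open MeasureTheory

/-- The map `(u, t) ↦ (1 - u, u t)`, which presents the standard simplex as the cone over one of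
its facets. -/
def cornerCone {k : ℕ} (u : unitInterval) (t : cornerSimplex k) : cornerSimplex (k + 1) :=
  ⟨Fin.cons (1 - (u : ℝ)) ((u : ℝ) • t.1), by
    refine ⟨fun i => ?_, ?_⟩
    · refine Fin.cases ?_ (fun j => ?_) i
      · simpa using u.2.2
      · simpa using mul_nonneg u.2.1 (t.2.1 j)
    · have := mul_le_of_le_one_right u.2.1 t.2.2
      rw [Fin.sum_univ_succ]
      simp only [Fin.cons_zero, Fin.cons_succ, Pi.smul_apply, smul_eq_mul, ← Finset.mul_sum]
      linarith⟩

theorem continuous_cornerCone (k : ℕ) :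
    Continuous fun p : unitInterval × cornerSimplex k => cornerCone p.1 p.2 := by
  refine Continuous.subtype_mk (continuous_pi fun i => ?_) _
  refine Fin.cases ?_ (fun j => ?_) i
  · simp only [Fin.cons_zero]
    fun_prop
  · simp only [Fin.cons_succ, Pi.smul_apply, smul_eq_mul]
    exact (by fun_prop : Continuous fun p : unitInterval × cornerSimplex k => (p.1 : ℝ)).mul
      ((continuous_apply j).comp (continuous_subtype_val.comp continuous_snd))

theorem isCompact_cornerSimplex (k : ℕ) : IsCompact (cornerSimplex k) :=
  isCompact_iff_compactSpace.2 inferInstance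

theorem integral_cornerMeasure (k : ℕ) (F : (Fin k → ℝ) → ℝ) :
    ∫ t, F (t : cornerSimplex k) ∂(cornerMeasure k) = ∫ x, (cornerSimplex k).indicator F x := by
  rw [integral_indicator (isCompact_cornerSimplex k).measurableSet]
  exact integral_subtype_comap (isCompact_cornerSimplex k).measurableSet F

theorem cons_mem_cornerSimplex_iff {k : ℕ} {a : ℝ} (h0 : 0 ≤ a) (h1 : a < 1) (r : Fin k → ℝ) :
    (Fin.cons a ((1 - a) • r) : Fin (k + 1) → ℝ) ∈ cornerSimplex (k + 1) ↔
      r ∈ cornerSimplex k := by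
  have ha : 0 < 1 - a := sub_pos.2 h1
  simp only [cornerSimplex, Set.mem_ofPred_eq, Fin.forall_fin_succ, Fin.cons_zero, Fin.cons_succ,
    Pi.smul_apply, smul_eq_mul, Fin.sum_univ_succ, ← Finset.mul_sum, mul_nonneg_iff_of_pos_left ha,
    h0, true_and]
  refine and_congr_right fun _ => ?_
  rw [← le_sub_iff_add_le', mul_le_iff_le_one_right ha]

theorem integral_cornerSimplex_succ {k : ℕ} (F : (Fin (k + 1) → ℝ) → ℝ)
    (hF : ContinuousOn F (cornerSimplex (k + 1))) :
    ∫ x, (cornerSimplex (k + 1)).indicator F x = ∫ u in (0 : ℝ)..1, u ^ k *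
      ∫ r, (cornerSimplex k).indicator (fun r => F (Fin.cons (1 - u) (u • r))) r := by
  set G := (cornerSimplex (k + 1)).indicator F with hG
  have hGi : Integrable G := (integrable_indicator_iff
    (isCompact_cornerSimplex (k + 1)).measurableSet).2
      (hF.integrableOn_compact (isCompact_cornerSimplex (k + 1)))
  have hmp := (volume_preserving_piFinSuccAbove (fun _ : Fin (k + 1) => ℝ) 0).symm
  have hcons : ∀ p : ℝ × (Fin k → ℝ), (MeasurableEquiv.piFinSuccAbove
      (fun _ : Fin (k + 1) => ℝ) 0).symm p = (Fin.cons p.1 p.2 : Fin (k + 1) → ℝ) := fun p => by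
    simp [MeasurableEquiv.piFinSuccAbove, Fin.insertNthEquiv]
  have hGp : Integrable (fun p : ℝ × (Fin k → ℝ) => G (Fin.cons p.1 p.2))
      (volume.prod volume) := by
    have := (hmp.integrable_comp_emb (MeasurableEquiv.measurableEmbedding _)).2 hGi
    refine this.congr (Filter.Eventually.of_forall fun p => ?_)
    simp only [Function.comp_apply, hcons]
  have h1 : ∫ x, G x = ∫ a : ℝ, ∫ r : Fin k → ℝ, G (Fin.cons a r) := by
    rw [← hmp.integral_comp (MeasurableEquiv.measurableEmbedding _), ← integral_prod _ hGp]
    simp only [hcons]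
    rfl
  have h2 : ∀ a ∉ Set.Icc (0 : ℝ) 1, ∫ r : Fin k → ℝ, G (Fin.cons a r) = 0 := by
    intro a ha
    refine integral_eq_zero_of_ae (Filter.Eventually.of_forall fun r => ?_)
    refine Set.indicator_of_notMem (fun hm => ha ⟨by simpa using hm.1 0, ?_⟩) _
    have h3 := hm.2
    rw [Fin.sum_univ_succ] at h3
    have h4 : 0 ≤ ∑ i : Fin k, (Fin.cons a r : Fin (k + 1) → ℝ) i.succ :=
      Finset.sum_nonneg fun i _ => hm.1 _
    simp only [Fin.cons_zero] at h3
    linarith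
  have h3 : ∀ a ∈ Set.Ico (0 : ℝ) 1, ∫ r : Fin k → ℝ, G (Fin.cons a r) = (1 - a) ^ k *
      ∫ r, (cornerSimplex k).indicator (fun r => F (Fin.cons a ((1 - a) • r))) r := by
    intro a ha
    have ha' : 0 < 1 - a := sub_pos.2 ha.2
    have h4 := Measure.integral_comp_smul (volume : Measure (Fin k → ℝ))
      (fun r => G (Fin.cons a r)) (1 - a)
    rw [Module.finrank_fin_fun, abs_of_pos (by positivity), smul_eq_mul] at h4
    rw [← mul_inv_cancel_left₀ (pow_pos ha' k).ne' (∫ r : Fin k → ℝ, G (Fin.cons a r)), ← h4]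
    congr 2
    funext r
    by_cases hr : r ∈ cornerSimplex k
    · rw [Set.indicator_of_mem hr, hG,
        Set.indicator_of_mem ((cons_mem_cornerSimplex_iff ha.1 ha.2 r).2 hr)]
    · rw [Set.indicator_of_notMem hr, hG,
        Set.indicator_of_notMem fun h => hr ((cons_mem_cornerSimplex_iff ha.1 ha.2 r).1 h)]
  rw [h1, ← setIntegral_eq_integral_of_forall_compl_eq_zero h2, integral_Icc_eq_integral_Ico,
    setIntegral_congr_fun measurableSet_Ico h3, ← integral_Icc_eq_integral_Ico,
    integral_Icc_eq_integral_Ioc, ← intervalIntegral.integral_of_le zero_le_one]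
  have h5 := intervalIntegral.integral_comp_sub_left (a := 0) (b := 1) (fun u : ℝ => u ^ k *
      ∫ r, (cornerSimplex k).indicator (fun r => F (Fin.cons (1 - u) (u • r))) r) 1
  simp only [sub_sub_cancel, sub_self, sub_zero] at h5
  exact h5

/-- The integral over the standard simplex, computed along the rays from a vertex. -/
theorem integral_cornerMeasure_succ {k : ℕ} {f : cornerSimplex (k + 1) → ℝ} (hf : Continuous f) :
    ∫ t, f t ∂(cornerMeasure (k + 1)) =
      ∫ u : unitInterval, (u : ℝ) ^ k * ∫ t, f (cornerCone u t) ∂(cornerMeasure k) := by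
  classical
  -- extend `f` by zero
  set F : (Fin (k + 1) → ℝ) → ℝ := fun x =>
    if h : x ∈ cornerSimplex (k + 1) then f ⟨x, h⟩ else 0 with hFdef
  have hFf : ∀ t : cornerSimplex (k + 1), F t = f t := fun t => by simp [hFdef]
  have hF : ContinuousOn F (cornerSimplex (k + 1)) :=
    continuousOn_iff_continuous_domRestrict.2 (hf.congr fun t => (hFf t).symm)
  have h1 := integral_cornerSimplex_succ F hF
  rw [← integral_cornerMeasure, ← integral_unitInterval_eq_intervalIntegral (fun u : ℝ => u ^ k *
    ∫ r, (cornerSimplex k).indicator (fun r => F (Fin.cons (1 - u) (u • r))) r)] at h1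
  simp only [hFf] at h1
  rw [h1]
  refine integral_congr_ae (Filter.Eventually.of_forall fun u => ?_)
  simp only [← integral_cornerMeasure]
  congr 2
  funext t
  exact hFf (cornerCone u t)

end

/-! ### Integrals over the faces of a simplex -/

section

variable {E : Type u} [NormedAddCommGroup E] [InnerProductSpace ℝ E]

open MeasureTheory

namespace SimplexForm

variable {s t : Finset E} {k : ℕ}

/-- The point with the parameter `t` of the possibly degenerate simplex with the vertices
`e₀, …, e_k`. -/
def tuplePoint (e : Fin (k + 1) → s) (t : cornerSimplex k) : closedSimplex s :=
  ⟨(e 0 : E) + ∑ i, t.1 i • ((e i.succ : E) - e 0), by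
    have key : (e 0 : E) + ∑ i, t.1 i • ((e i.succ : E) - e 0) =
        ∑ i : Fin (k + 1), (Fin.cons (1 - ∑ i, t.1 i) t.1 : Fin (k + 1) → ℝ) i • (e i : E) := by
      simp only [Fin.sum_univ_succ, Fin.cons_zero, Fin.cons_succ, smul_sub,
        Finset.sum_sub_distrib, ← Finset.sum_smul, sub_smul, one_smul]
      abel
    rw [key]
    refine (convex_convexHull ℝ _).sum_mem (fun i _ => ?_) ?_
      fun i _ => subset_convexHull ℝ _ (e i).2
    · refine Fin.cases ?_ (fun j => ?_) i
      · simpa using t.2.2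
      · simpa using t.2.1 j
    · simp [Fin.sum_univ_succ]⟩

theorem continuous_tuplePoint (e : Fin (k + 1) → s) : Continuous (tuplePoint e) :=
  Continuous.subtype_mk (continuous_const.add (continuous_finsetSum _ fun i _ =>
    ((continuous_apply i).comp continuous_subtype_val).smul continuous_const)) _

/-- The vectors `e_{i+1} - e₀`. -/
def tupleFrame (e : Fin (k + 1) → s) (i : Fin k) : SimplexTangent s :=
  ⟨(e i.succ : E) - e 0, vsub_mem_vectorSpan ℝ (e i.succ).2 (e 0).2⟩

theorem continuous_tupleIntegrand (e : Fin (k + 1) → s) (α : SimplexForm s k) :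
    Continuous fun t => α (tuplePoint e t) (tupleFrame e) :=
  (continuous_eval_const (tupleFrame e)).comp (α.continuous.comp (continuous_tuplePoint e))

theorem integrable_tupleIntegrand (e : Fin (k + 1) → s) (α : SimplexForm s k) :
    Integrable (fun t => α (tuplePoint e t) (tupleFrame e)) (cornerMeasure k) :=
  (continuous_tupleIntegrand e α).integrable_of_hasCompactSupport
    (HasCompactSupport.of_compactSpace _)

/-- The integral of a form over the simplex with the vertices `e₀, …, e_k`, which need not be
distinct. -/
def tupleIntegral (e : Fin (k + 1) → s) : SimplexForm s k →L[ℝ] ℝ :=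
  LinearMap.mkContinuous
    { toFun := fun α => ∫ t, α (tuplePoint e t) (tupleFrame e) ∂(cornerMeasure k)
      map_add' := fun α β => integral_add (integrable_tupleIntegrand e α)
        (integrable_tupleIntegrand e β)
      map_smul' := fun c α => integral_const_mul c _ }
    ((∏ i, ‖tupleFrame e i‖) * (cornerMeasure k).real Set.univ) fun α => by
      refine (norm_integral_le_of_norm_le_const
        (C := ‖α‖ * ∏ i, ‖tupleFrame e i‖) (Filter.Eventually.of_forall fun t => ?_)).trans
          (le_of_eq (by ring))
      exact ((α (tuplePoint e t)).le_opNorm _).trans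
        (mul_le_mul_of_nonneg_right (α.norm_apply_le _) (Finset.prod_nonneg fun _ _ =>
          norm_nonneg _))

theorem tupleIntegral_apply (e : Fin (k + 1) → s) (α : SimplexForm s k) :
    tupleIntegral e α = ∫ t, α (tuplePoint e t) (tupleFrame e) ∂(cornerMeasure k) := rfl

theorem simplexIntegral_restrict (v : Fin (k + 1) ↪ E) (h : Finset.univ.map v ⊆ s)
    (α : SimplexForm s k) :
    simplexIntegral v (restrict h k α) =
      tupleIntegral (fun i => ⟨v i, h (Finset.mem_map_of_mem v (Finset.mem_univ i))⟩) α := rfl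

theorem tupleIntegral_of_not_injective {e : Fin (k + 1) → s} (he : ¬Function.Injective e)
    (α : SimplexForm s k) : tupleIntegral e α = 0 := by
  have h0 : ∀ x, α x (tupleFrame e) = 0 := by
    intro x
    simp only [Function.Injective, not_forall] at he
    obtain ⟨i, j, hij, hne⟩ := he
    have hz : ∀ m : Fin k, e m.succ = e 0 → tupleFrame e m = 0 := fun m hm =>
      Subtype.ext (by simp only [tupleFrame, hm, sub_self]; rfl)
    rcases Fin.eq_zero_or_eq_succ i with rfl | ⟨i, rfl⟩
    · rcases Fin.eq_zero_or_eq_succ j with rfl | ⟨j, rfl⟩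
      · exact (hne rfl).elim
      · exact (α x).map_coord_zero j (hz j hij.symm)
    · rcases Fin.eq_zero_or_eq_succ j with rfl | ⟨j, rfl⟩
      · exact (α x).map_coord_zero i (hz i hij)
      · refine (α x).map_eq_zero_of_eq _ (i := i) (j := j) ?_ fun h => hne (by rw [h])
        exact Subtype.ext (by simp [tupleFrame, hij])
  rw [tupleIntegral_apply]
  simp [h0]

/-- The tuple `(e₀, v, e₁, …, e_k)`. -/
def insertSecond (e : Fin (k + 1) → s) (v : s) : Fin (k + 2) → s :=
  Fin.cons (e 0) (Fin.cons v fun i : Fin k => e i.succ)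

theorem segmentPoint_tuplePoint (e : Fin (k + 1) → s) (v : s) (t : cornerSimplex k)
    (u : unitInterval) :
    segmentPoint v (tuplePoint e t) u = tuplePoint (insertSecond e v) (cornerCone u t) := by
  refine Subtype.ext ?_
  simp only [segmentPoint, tuplePoint, insertSecond, cornerCone, Fin.cons_zero, Fin.cons_succ,
    Fin.sum_univ_succ (n := k), Pi.smul_apply, smul_eq_mul, mul_smul, ← Finset.smul_sum]
  module

theorem tupleFrame_insertSecond (e : Fin (k + 1) → s) (v : s) :
    tupleFrame (insertSecond e v) = Matrix.vecCons (tupleFrame (insertSecond e v) 0)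
      (tupleFrame e) := by
  funext i
  refine Fin.cases rfl (fun j => ?_) i
  rfl

theorem rayVector_tuplePoint (e : Fin (k + 1) → s) (v : s) (t : cornerSimplex k) :
    rayVector v (tuplePoint e t) =
      -tupleFrame (insertSecond e v) 0 + ∑ i, t.1 i • tupleFrame e i := by
  have h : SimplexTangent.toAmbient s (rayVector v (tuplePoint e t)) =
      SimplexTangent.toAmbient s
        (-tupleFrame (insertSecond e v) 0 + ∑ i, t.1 i • tupleFrame e i) := by
    rw [map_add, map_neg, map_sum]
    simp only [map_smul]
    change (e 0 : E) + ∑ i, t.1 i • ((e i.succ : E) - e 0) - v =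
      -((v : E) - e 0) + ∑ i, t.1 i • ((e i.succ : E) - e 0)
    abel
  exact Subtype.ext h

/-- Integration over a simplex and the cone operator: the integral of `h_v α` over a simplex is,
up to sign, the integral of `α` over the join of `v` with this simplex. -/
theorem tupleIntegral_cone (e : Fin (k + 1) → s) (v : s) (α : SimplexForm s (k + 1)) :
    tupleIntegral e (cone v α) = -tupleIntegral (insertSecond e v) α := by
  have h1 : ∀ (t : cornerSimplex k) (u : unitInterval),
      ((u : ℝ) ^ k • contractL (α (segmentPoint v (tuplePoint e t) u))
        (rayVector v (tuplePoint e t))) (tupleFrame e) = -((u : ℝ) ^ k *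
          α (tuplePoint (insertSecond e v) (cornerCone u t)) (tupleFrame (insertSecond e v))) := by
    intro t u
    rw [segmentPoint_tuplePoint, rayVector_tuplePoint]
    set β := α (tuplePoint (insertSecond e v) (cornerCone u t))
    -- the vectors of the frame contribute nothing, as they are repeated
    have h2 : ∀ i, β (Matrix.vecCons (tupleFrame e i) (tupleFrame e)) = 0 := fun i =>
      β.map_eq_zero_of_eq _ (i := 0) (j := i.succ) rfl (Fin.succ_ne_zero i).symm
    have h3 : contractL β (-tupleFrame (insertSecond e v) 0 + ∑ i, t.1 i • tupleFrame e i)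
        (tupleFrame e) =
        -β (Matrix.vecCons (tupleFrame (insertSecond e v) 0) (tupleFrame e)) := by
      have h4 : contractL β (∑ i, t.1 i • tupleFrame e i) (tupleFrame e) = 0 := by
        have := map_sum ((ContinuousAlternatingMap.apply ℝ (SimplexTangent s) ℝ
          (tupleFrame e)) ∘L contractL β) (fun i => t.1 i • tupleFrame e i) Finset.univ
        refine this.trans (Finset.sum_eq_zero fun i _ => ?_)
        rw [map_smul]
        exact (congrArg (t.1 i • ·) (h2 i)).trans (smul_zero _)
      rw [map_add, map_neg, ContinuousAlternatingMap.add_apply, h4, add_zero]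
      rfl
    rw [ContinuousAlternatingMap.smul_apply, h3, smul_eq_mul, mul_neg,
      ← tupleFrame_insertSecond e v]
  have h2 : ∀ t : cornerSimplex k, cone v α (tuplePoint e t) (tupleFrame e) =
      ∫ u : unitInterval, -((u : ℝ) ^ k *
        α (tuplePoint (insertSecond e v) (cornerCone u t)) (tupleFrame (insertSecond e v))) := by
    intro t
    simp only [← h1]
    exact ((ContinuousAlternatingMap.apply ℝ (SimplexTangent s) ℝ
      (tupleFrame e)).integral_comp_comm (continuous_coneIntegrand
        (α.continuous_comp_segmentPoint v (tuplePoint e t)) _).integrable_unitInterval).symm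
  have hc := continuous_tupleIntegrand (insertSecond e v) α
  rw [tupleIntegral_apply, tupleIntegral_apply, integral_cornerMeasure_succ hc]
  simp only [h2]
  rw [integral_integral_swap]
  · simp only [integral_neg, integral_const_mul]
  · have h3 : Continuous fun p : cornerSimplex k × unitInterval => -((p.2 : ℝ) ^ k *
        α (tuplePoint (insertSecond e v) (cornerCone p.2 p.1))
          (tupleFrame (insertSecond e v))) :=
      (((continuous_subtype_val.comp continuous_snd).pow k).mul
        (hc.comp ((continuous_cornerCone k).comp continuous_swap))).neg
    exact h3.integrable_of_hasCompactSupport (HasCompactSupport.of_compactSpace _)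

/-- The integral of a function over a vertex is its value there. -/
theorem tupleIntegral_zero (e : Fin 1 → s) (α : SimplexForm s 0) :
    tupleIntegral e α = α ⟨e 0, subset_convexHull ℝ _ (e 0).2⟩ 0 := by
  have h0 : ∀ x : Fin 0 → ℝ, x ∈ cornerSimplex 0 := fun x => ⟨fun i => i.elim0, by simp⟩
  have h1 : ∀ t, α (tuplePoint e t) (tupleFrame e) =
      α ⟨e 0, subset_convexHull ℝ _ (e 0).2⟩ 0 := by
    intro t
    rw [Subsingleton.elim (tupleFrame e) 0]
    congr 2
    exact Subtype.ext (by simp [tuplePoint])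
  rw [tupleIntegral_apply]
  simp only [h1]
  rw [integral_cornerMeasure 0 fun _ => α ⟨e 0, subset_convexHull ℝ _ (e 0).2⟩ 0]
  have h2 : cornerSimplex 0 = Set.univ := Set.eq_univ_of_forall h0
  rw [h2, Set.indicator_univ]
  simp [Measure.volume_pi_eq_dirac 0]

/-- The integrals of `α` over all faces of the simplex vanish. -/
def FaceIntegralsVanish (α : SimplexForm s k) : Prop :=
  ∀ e : Fin (k + 1) → s, tupleIntegral e α = 0

theorem FaceIntegralsVanish.cone {α : SimplexForm s (k + 1)} (h : FaceIntegralsVanish α) (v : s) :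
    FaceIntegralsVanish (SimplexForm.cone v α) := fun e => by
  rw [tupleIntegral_cone, h, neg_zero]

theorem FaceIntegralsVanish.constAt_eq_zero {α : SimplexForm s 0} (h : FaceIntegralsVanish α)
    (v : s) : constAt v α = 0 := by
  refine ext fun x => ContinuousAlternatingMap.ext fun w => ?_
  have h1 := h fun _ => v
  rw [tupleIntegral_zero] at h1
  rw [Subsingleton.elim w 0]
  exact h1

theorem FaceIntegralsVanish.residualComm_eq_zero {α : SimplexForm s k}
    (h : FaceIntegralsVanish α) : residualComm k α = 0 := by
  induction k with
  | zero =>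
    rw [residualComm_zero]
    exact Finset.sum_eq_zero fun v _ => by rw [h.constAt_eq_zero, map_zero]
  | succ k ih =>
    rw [residualComm_succ]
    exact Finset.sum_eq_zero fun v _ => by rw [ih (h.cone v), map_zero]

theorem FaceIntegralsVanish.whitney_eq_zero {α : SimplexForm s k}
    (h : FaceIntegralsVanish α) : whitney k α = 0 := by
  cases k with
  | zero =>
    rw [whitney_zero]
    exact Finset.sum_eq_zero fun v _ => by rw [h.constAt_eq_zero, map_zero]
  | succ k =>
    rw [whitney_succ]
    exact Finset.sum_eq_zero fun v _ => by rw [(h.cone v).residualComm_eq_zero, map_zero]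

/-- The closure of the pairs that consist of a smooth form and its exterior derivative. -/
def weakPairs (s : Finset E) (k : ℕ) : Set (SimplexForm s k × SimplexForm s (k + 1)) :=
  closure {p | p.1.IsSmoothWithDeriv p.2}

/-- The operator `(α, dα) ↦ (h_v α, d h_v α) = (h_v α, α - h_v dα)`. -/
def conePair (v : s) (p : SimplexForm s (k + 1) × SimplexForm s (k + 2)) :
    SimplexForm s k × SimplexForm s (k + 1) := (cone v p.1, p.1 - cone v p.2)

theorem continuous_conePair (v : s) : Continuous (conePair (k := k) v) :=
  ((cone v).continuous.comp continuous_fst).prodMk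
    (continuous_fst.sub ((cone v).continuous.comp continuous_snd))

theorem cone_mem_weakPairs {α : SimplexForm s (k + 1)} {η : SimplexForm s (k + 2)}
    (h : (α, η) ∈ weakPairs s (k + 1)) (v : s) : (cone v α, α - cone v η) ∈ weakPairs s k := by
  have hm : Set.MapsTo (conePair (k := k) v) {p | p.1.IsSmoothWithDeriv p.2}
      {p | p.1.IsSmoothWithDeriv p.2} := by
    intro p hp
    exact IsSmoothWithDeriv.cone hp v
  have h1 := map_mem_closure (continuous_conePair v) h hm
  exact h1

theorem cone_eq_of_mem_weakPairs {α : SimplexForm s 0} {η : SimplexForm s 1}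
    (h : (α, η) ∈ weakPairs s 0) (v : s) : cone v η = α - constAt v α := by
  have hc : IsClosed {p : SimplexForm s 0 × SimplexForm s 1 | cone v p.2 = p.1 - constAt v p.1} :=
    isClosed_eq ((cone v).continuous.comp continuous_snd)
      (continuous_fst.sub ((constAt v).continuous.comp continuous_fst))
  have hm : {p : SimplexForm s 0 × SimplexForm s 1 | p.1.IsSmoothWithDeriv p.2} ⊆
      {p | cone v p.2 = p.1 - constAt v p.1} := by
    intro p hp
    exact IsSmoothWithDeriv.cone_eq hp v
  have h1 := closure_minimal hm hc h
  exact h1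

/-- The homotopy formula `S d = 1 - W` in degree `0`. -/
theorem dupont_zero_of_mem_weakPairs {α : SimplexForm s 0} {η : SimplexForm s 1}
    (h : (α, η) ∈ weakPairs s 0) : dupont 0 η = α - whitney 0 α := by
  rw [dupont_apply, whitney_zero]
  simp only [residual_zero, cone_eq_of_mem_weakPairs h, map_sub, Finset.sum_sub_distrib,
    sum_mulBary]

/-- If the integrals of a form over all faces vanish, then so do those of its differential; this
is the part of Stokes' theorem that is needed.  The integral of `dα` over a simplex is an integral
of `h dα = α - d h α`, where `h` is the cone operator for one of the vertices. -/
theorem FaceIntegralsVanish.of_mem_weakPairs {α : SimplexForm s k} {η : SimplexForm s (k + 1)}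
    (h : (α, η) ∈ weakPairs s k) (hα : FaceIntegralsVanish α) : FaceIntegralsVanish η := by
  have key : ∀ {m : ℕ} (e : Fin (m + 2) → s), insertSecond
      (Fin.cons (e 0) fun i => e i.succ.succ : Fin (m + 1) → s) (e 1) = e := by
    intro m e
    funext i
    refine Fin.cases rfl (fun j => ?_) i
    exact Fin.cases rfl (fun l => rfl) j
  induction k with
  | zero =>
    intro e
    have h1 := tupleIntegral_cone (Fin.cons (e 0) fun i => e i.succ.succ : Fin 1 → s) (e 1) η
    rw [key, cone_eq_of_mem_weakPairs h, hα.constAt_eq_zero, sub_zero, hα] at h1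
    exact neg_eq_zero.1 h1.symm
  | succ k ih =>
    intro e
    have h1 := tupleIntegral_cone (Fin.cons (e 0) fun i => e i.succ.succ : Fin (k + 2) → s)
      (e 1) η
    have h2 := ih (cone_mem_weakPairs h (e 1)) (hα.cone (e 1))
      (Fin.cons (e 0) fun i => e i.succ.succ : Fin (k + 2) → s)
    rw [map_sub, hα, zero_sub, neg_eq_zero] at h2
    rw [key, h2] at h1
    exact neg_eq_zero.1 h1.symm

/-- On a simplex of dimension `k` there are no forms of degree `k + 1`. -/
theorem eq_zero_of_card_le (h : s.card ≤ k) (α : SimplexForm s k) : α = 0 := by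
  refine ext fun x => ContinuousAlternatingMap.ext fun w => ?_
  have hs : s.Nonempty := by
    have := convexHull_nonempty_iff.1 ⟨_, x.2⟩
    exact_mod_cast this
  refine (α x).toAlternatingMap.map_linearDependent w fun hw => ?_
  have : FiniteDimensional ℝ (SimplexTangent s) :=
    finiteDimensional_vectorSpan_of_finite ℝ s.finite_toSet
  have h1 := hw.fintype_card_le_finrank
  rw [Fintype.card_fin] at h1
  have h2 : Module.finrank ℝ (SimplexTangent s) + 1 ≤ s.card := by
    have : Nonempty s := hs.to_subtype
    have h3 := finrank_vectorSpan_range_add_one_le ℝ (Subtype.val : s → E)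
    have h4 : Set.range (Subtype.val : s → E) = s := Subtype.range_coe
    rw [Fintype.card_coe, congrArg (fun S : Set E => Module.finrank ℝ (vectorSpan ℝ S)) h4] at h3
    exact h3
  omega

end SimplexForm

end

/-! ### Families of operators on `ℓ^p` sums -/

section

variable {E : Type u} [NormedAddCommGroup E] [InnerProductSpace ℝ E]

open Filter Topology

/-- A uniformly bounded family of bounded operators `A i → B i` induces a bounded operator from the
`ℓ^p` sum of the `A i` to the `ℓ^q` sum of the `B i`, if `p ≤ q`. -/
def lpFamilyMap {ι : Type*} {A B : ι → Type*} [∀ i, NormedAddCommGroup (A i)]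
    [∀ i, NormedSpace ℝ (A i)] [∀ i, CompleteSpace (A i)] [∀ i, NormedAddCommGroup (B i)]
    [∀ i, NormedSpace ℝ (B i)] [∀ i, CompleteSpace (B i)] {p q : ℝ≥0∞} [Fact (1 ≤ p)]
    [Fact (1 ≤ q)] (hpq : p ≤ q) (F : ∀ i, A i →L[ℝ] B i) (hF : ∃ C : ℝ, ∀ i, ‖F i‖ ≤ C) :
    lp A p →L[ℝ] lp B q :=
  let g : lp A p →ₗ[ℝ] lp B q :=
    { toFun := fun f => ⟨fun i => F i (f i), by
        obtain ⟨C, hC⟩ := hF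
        refine ((lp.memℓp (C • f)).mono' fun i => ?_).of_exponent_ge hpq
        rw [lp.coeFn_smul, Pi.smul_apply, norm_smul]
        exact ((F i).le_opNorm _).trans (mul_le_mul_of_nonneg_right
          ((hC i).trans (Real.le_norm_self C)) (norm_nonneg _))⟩
      map_add' := fun f f' => lp.ext (funext fun i => map_add (F i) (f i) (f' i))
      map_smul' := fun c f => lp.ext (funext fun i => map_smul (F i) c (f i)) }
  -- the graph is closed, since the coordinates are continuous
  ⟨g, g.continuous_of_seq_closed_graph fun u x y hu hgu => lp.ext (funext fun i => by
    have h1 : Tendsto (fun m => F i (u m i)) atTop (𝓝 (y i)) :=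
      ((lp.evalCLM ℝ B q i).continuous.tendsto y).comp hgu
    have h2 : Tendsto (fun m => F i (u m i)) atTop (𝓝 (F i (x i))) :=
      ((F i).continuous.tendsto _).comp (((lp.evalCLM ℝ A p i).continuous.tendsto x).comp hu)
    exact tendsto_nhds_unique h1 h2)⟩

/-! ### The contracting homotopy on the complex -/

variable {n : ℕ}

theorem ExponentSequence.exponent_succ_le {π : ExponentSequence n} (hπ : Antitone π.val) (k : ℕ) :
    π.exponent (k + 1) ≤ π.exponent k :=
  ENNReal.ofReal_le_ofReal (hπ (Fin.mk_le_mk.2 (min_le_min_right n k.le_succ)))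

namespace BoundedGeometryComplex

variable (K : BoundedGeometryComplex E n) (π : ExponentSequence n) {k : ℕ}

theorem unitEdges (T : K.Top) : UnitEdges T.1 := K.edge_length T.1 T.2.1

/-- The homotopy operator, applied on each `n`-simplex.  As the exponents do not increase, it maps
`ℓ^{p_{k+1}}` families to `ℓ^{p_k}` families. -/
def dupontFamily {π : ExponentSequence n} (hπ : Antitone π.val) (k : ℕ) :
    FormFamilies K π (k + 1) →L[ℝ] FormFamilies K π k :=
  lpFamilyMap (ExponentSequence.exponent_succ_le hπ k)
    (fun T : K.Top => SimplexForm.dupont (s := T.1) k) (by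
      obtain ⟨C, hC⟩ := SimplexForm.exists_norm_dupont_le (E := E) (n + 1) k
      exact ⟨C, fun T => hC T.1 (K.unitEdges T) T.2.2⟩)

/-- The projection to Whitney forms, applied on each `n`-simplex. -/
def whitneyFamily (k : ℕ) : FormFamilies K π k →L[ℝ] FormFamilies K π k :=
  lpFamilyMap le_rfl (fun T : K.Top => SimplexForm.whitney (s := T.1) k) (by
      obtain ⟨C, hC⟩ := SimplexForm.exists_norm_whitney_le (E := E) (n + 1) k
      exact ⟨C, fun T => hC T.1 (K.unitEdges T) T.2.2⟩)

/-- The map `(α, η) ↦ (S α, α - S η - W α)`; for `η = dα` the second component is `d S α`. -/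
def pairHomotopy {π : ExponentSequence n} (hπ : Antitone π.val) (k : ℕ) :
    FormPairs K π (k + 1) →L[ℝ] FormPairs K π k :=
  (WithLp.prodContinuousLinearEquiv 1 ℝ (FormFamilies K π k)
      (FormFamilies K π (k + 1))).symm.toContinuousLinearMap ∘L
    ContinuousLinearMap.prod
      (K.dupontFamily hπ k ∘L
        WithLp.fstL 1 ℝ (FormFamilies K π (k + 1)) (FormFamilies K π (k + 1 + 1)))
      (WithLp.fstL 1 ℝ (FormFamilies K π (k + 1)) (FormFamilies K π (k + 1 + 1)) -
        K.dupontFamily hπ (k + 1) ∘L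
          WithLp.sndL 1 ℝ (FormFamilies K π (k + 1)) (FormFamilies K π (k + 1 + 1)) -
        K.whitneyFamily π (k + 1) ∘L
          WithLp.fstL 1 ℝ (FormFamilies K π (k + 1)) (FormFamilies K π (k + 1 + 1)))

theorem pairHomotopy_mem_smoothForms {π : ExponentSequence n} (hπ : Antitone π.val)
    {z : FormPairs K π (k + 1)} (hz : z ∈ smoothForms K π (k + 1)) :
    K.pairHomotopy hπ k z ∈ smoothForms K π k := by
  obtain ⟨h1, h2, h3⟩ := hz
  refine ⟨fun T => (h1 T).dupont, fun T T' s h h' => ?_, fun T T' s h h' => ?_⟩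
  · have e2 := h2 T T' s h h'
    change SimplexForm.restrict h (k + 1) (z.fst T) =
      SimplexForm.restrict h' (k + 1) (z.fst T') at e2
    change SimplexForm.restrict h k (SimplexForm.dupont k (z.fst T)) =
      SimplexForm.restrict h' k (SimplexForm.dupont k (z.fst T'))
    rw [SimplexForm.restrict_dupont (K.unitEdges T),
      SimplexForm.restrict_dupont (K.unitEdges T'), e2]
  · have e2 := h2 T T' s h h'
    have e3 := h3 T T' s h h'
    change SimplexForm.restrict h (k + 1) (z.fst T) =
      SimplexForm.restrict h' (k + 1) (z.fst T') at e2
    change SimplexForm.restrict h (k + 1 + 1) (z.snd T) =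
      SimplexForm.restrict h' (k + 1 + 1) (z.snd T') at e3
    change SimplexForm.restrict h (k + 1) (z.fst T - SimplexForm.dupont (k + 1) (z.snd T) -
        SimplexForm.whitney (k + 1) (z.fst T)) =
      SimplexForm.restrict h' (k + 1) (z.fst T' - SimplexForm.dupont (k + 1) (z.snd T') -
        SimplexForm.whitney (k + 1) (z.fst T'))
    simp only [map_sub]
    rw [SimplexForm.restrict_dupont (K.unitEdges T),
      SimplexForm.restrict_dupont (K.unitEdges T'), SimplexForm.restrict_whitney (K.unitEdges T),
      SimplexForm.restrict_whitney (K.unitEdges T'), e2, e3]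

theorem pairHomotopy_mem_closure {π : ExponentSequence n} (hπ : Antitone π.val)
    (z : FormPairs K π (k + 1)) (hz : z ∈ (smoothForms K π (k + 1)).topologicalClosure) :
    K.pairHomotopy hπ k z ∈ (smoothForms K π k).topologicalClosure :=
  map_mem_closure (K.pairHomotopy hπ k).continuous hz
    fun _ h => K.pairHomotopy_mem_smoothForms hπ h

/-- The homotopy operator on the complex of the spaces `SL^k_π(K)`. -/
def homotopySL {π : ExponentSequence n} (hπ : Antitone π.val) (k : ℕ) :
    SL K π (k + 1) →L[ℝ] SL K π k :=
  (K.pairHomotopy hπ k).restrict (K.pairHomotopy_mem_closure hπ)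

variable {K π}

/-- Evaluation of a pair of families at an `n`-simplex. -/
def evalPair (T : K.Top) :
    FormPairs K π k →L[ℝ] SimplexForm T.1 k × SimplexForm T.1 (k + 1) :=
  (lp.evalCLM ℝ (fun T : K.Top => SimplexForm T.1 k) (π.exponent k) T ∘L
      WithLp.fstL 1 ℝ (FormFamilies K π k) (FormFamilies K π (k + 1))).prod
    (lp.evalCLM ℝ (fun T : K.Top => SimplexForm T.1 (k + 1)) (π.exponent (k + 1)) T ∘L
      WithLp.sndL 1 ℝ (FormFamilies K π k) (FormFamilies K π (k + 1)))

/-- The restrictions to common faces agree for all members of the closure `SL^k_π(K)`. -/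
theorem compatible_fst (z : SL K π k) : Compatible K (fun T => z.1.fst T) := by
  intro T T' s h h'
  have hc : IsClosed {w : FormPairs K π k | SimplexForm.restrict h k (evalPair T w).1 =
      SimplexForm.restrict h' k (evalPair T' w).1} :=
    isClosed_eq ((SimplexForm.restrict h k).continuous.comp
        (continuous_fst.comp (evalPair T).continuous))
      ((SimplexForm.restrict h' k).continuous.comp
        (continuous_fst.comp (evalPair T').continuous))
  have hm : (smoothForms K π k : Set (FormPairs K π k)) ⊆
      {w | SimplexForm.restrict h k (evalPair T w).1 =
        SimplexForm.restrict h' k (evalPair T' w).1} := by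
    intro w hw
    exact hw.2.1 T T' s h h'
  have h1 := closure_minimal hm hc z.2
  exact h1

/-- On each `n`-simplex, a pair in `SL^k_π(K)` is a limit of pairs of a smooth form and its
differential. -/
theorem mem_weakPairs (z : SL K π k) (T : K.Top) :
    (z.1.fst T, z.1.snd T) ∈ SimplexForm.weakPairs T.1 k := by
  have hm : Set.MapsTo (evalPair T) (smoothForms K π k : Set (FormPairs K π k))
      {p | p.1.IsSmoothWithDeriv p.2} := by
    intro w hw
    exact hw.1 T
  have h1 := map_mem_closure (evalPair T).continuous z.2 hm
  exact h1

theorem deRhamMap_apply (z : SL K π k) (v : K.OrderedSimplex k) :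
    deRhamMap K π k z v =
      simplexIntegral v.1 (SimplexForm.restrict (K.subset_top v) k (z.1.fst (K.top v))) := rfl

/-- The kernel condition concerns all `k`-simplices of `K`, so in particular all the faces of `T`;
tuples of vertices with a repetition contribute zero integrals anyway. -/
theorem faceIntegralsVanish {z : SL K π k} (hz : z ∈ kerDeRham K π k) (T : K.Top) :
    SimplexForm.FaceIntegralsVanish (z.1.fst T) := by
  intro e
  by_cases he : Function.Injective e
  · let v : Fin (k + 1) ↪ E := ⟨fun i => e i, Subtype.val_injective.comp he⟩
    have hv : Finset.univ.map v ⊆ T.1 := by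
      intro x hx
      obtain ⟨i, -, rfl⟩ := Finset.mem_map.1 hx
      exact (e i).2
    have hface : Finset.univ.map v ∈ K.faces :=
      K.down_closed T.2.1 hv (Finset.univ_nonempty.map)
    have h1 := congrFun (LinearMap.mem_ker.1 hz) ⟨v, hface⟩
    have h2 := deRhamMap_apply z ⟨v, hface⟩
    rw [compatible_fst z _ T _ (K.subset_top ⟨v, hface⟩) hv,
      SimplexForm.simplexIntegral_restrict] at h2
    exact h2.symm.trans h1
  · exact SimplexForm.tupleIntegral_of_not_injective he _

/-- The differential maps the kernel of the de Rham map into itself. -/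
theorem kerIsSubcomplex (K : BoundedGeometryComplex E n) (π : ExponentSequence n) :
    KerIsSubcomplex K π := by
  intro k z hz
  refine LinearMap.mem_ker.2 (funext fun v => ?_)
  refine (deRhamMap_apply (SL.d K π k z) v).trans ?_
  rw [SimplexForm.simplexIntegral_restrict]
  exact (faceIntegralsVanish hz (K.top v)).of_mem_weakPairs (mem_weakPairs z (K.top v)) _

/-- The homotopy operator takes values in the kernel of the de Rham map: on a simplex of dimension
`k` it only involves the restriction to this simplex of a form of degree `k + 1`. -/
theorem homotopySL_mem_kerDeRham (hπ : Antitone π.val) (z : SL K π (k + 1)) :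
    K.homotopySL hπ k z ∈ kerDeRham K π k := by
  refine LinearMap.mem_ker.2 (funext fun v => ?_)
  refine (deRhamMap_apply _ v).trans ?_
  have h1 : SimplexForm.restrict (K.subset_top v) k
      ((K.homotopySL hπ k z).1.fst (K.top v)) = 0 := by
    refine (SimplexForm.restrict_dupont (K.unitEdges _) (K.subset_top v)
      (z.1.fst (K.top v))).trans ?_
    rw [SimplexForm.eq_zero_of_card_le (by simp) (SimplexForm.restrict (K.subset_top v) (k + 1)
      (z.1.fst (K.top v))), map_zero]
  rw [h1, map_zero]
  rfl

theorem SL_ext {z w : SL K π k} (h1 : ∀ T, z.1.fst T = w.1.fst T)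
    (h2 : ∀ T, z.1.snd T = w.1.snd T) : z = w :=
  Subtype.ext (WithLp.ofLp_injective 1 (Prod.ext (lp.ext (funext h1)) (lp.ext (funext h2))))

/-- The homotopy formula on the kernel of the de Rham map in positive degrees. -/
theorem d_homotopySL_add (hπ : Antitone π.val) {z : SL K π (k + 1)}
    (hz : z ∈ kerDeRham K π (k + 1)) :
    SL.d K π k (K.homotopySL hπ k z) + K.homotopySL hπ (k + 1) (SL.d K π (k + 1) z) = z := by
  have hdz := kerIsSubcomplex K π (k + 1) z hz
  refine SL_ext (fun T => ?_) fun T => ?_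
  · change (z.1.fst T - SimplexForm.dupont (k + 1) (z.1.snd T) -
      SimplexForm.whitney (k + 1) (z.1.fst T)) + SimplexForm.dupont (k + 1) (z.1.snd T) = z.1.fst T
    rw [(faceIntegralsVanish hz T).whitney_eq_zero]
    abel
  · change (0 : SimplexForm T.1 (k + 2)) + (z.1.snd T - SimplexForm.dupont (k + 2) 0 -
      SimplexForm.whitney (k + 2) (z.1.snd T)) = z.1.snd T
    have h1 : SimplexForm.whitney (k + 2) (z.1.snd T) = 0 :=
      (faceIntegralsVanish hdz T).whitney_eq_zero
    rw [h1, map_zero]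
    abel

/-- The homotopy formula on the kernel of the de Rham map in degree `0`. -/
theorem homotopySL_d_zero (hπ : Antitone π.val) {z : SL K π 0} (hz : z ∈ kerDeRham K π 0) :
    K.homotopySL hπ 0 (SL.d K π 0 z) = z := by
  have hdz := kerIsSubcomplex K π 0 z hz
  refine SL_ext (fun T => ?_) fun T => ?_
  · change SimplexForm.dupont 0 (z.1.snd T) = z.1.fst T
    rw [SimplexForm.dupont_zero_of_mem_weakPairs (mem_weakPairs z T),
      (faceIntegralsVanish hz T).whitney_eq_zero, sub_zero]
  · change z.1.snd T - SimplexForm.dupont 1 0 - SimplexForm.whitney 1 (z.1.snd T) = z.1.snd T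
    have h1 : SimplexForm.whitney 1 (z.1.snd T) = 0 :=
      (faceIntegralsVanish hdz T).whitney_eq_zero
    rw [h1, map_zero]
    abel

/-- The contracting homotopy of the kernel of the de Rham map. -/
def homotopyKer (hπ : Antitone π.val) (k : ℕ) : kerDeRham K π (k + 1) →L[ℝ] kerDeRham K π k :=
  (K.homotopySL hπ k).restrict fun z _ => homotopySL_mem_kerDeRham hπ z

end BoundedGeometryComplex

end

/-! ### Contractions of cochain complexes -/

/-- A contracting homotopy of a cochain complex `X 0 ⟶ X 1 ⟶ ⋯`, from its components. -/
def contractingHomotopy {V : Type*} [Category V] [Preadditive V] (X : ℕ → V)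
    (d : ∀ k, X k ⟶ X (k + 1)) (sq : ∀ k, d k ≫ d (k + 1) = 0) (S : ∀ k, X (k + 1) ⟶ X k)
    (h0 : d 0 ≫ S 0 = 𝟙 (X 0))
    (hS : ∀ k, S k ≫ d k + d (k + 1) ≫ S (k + 1) = 𝟙 (X (k + 1))) :
    Homotopy (𝟙 (CochainComplex.of X d sq)) 0 where
  hom i j := if h : j + 1 = i then eqToHom (congrArg X h.symm) ≫ S j else 0
  zero i j hij := dif_neg hij
  comm i := by
    cases i with
    | zero =>
      rw [prevD_eq_zero _ _ (by simp), dNext_eq _ (show (ComplexShape.up ℕ).Rel 0 1 from rfl),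
        show (CochainComplex.of X d sq).d 0 1 = d 0 from CochainComplex.of_d X d 0]
      simpa using h0.symm
    | succ k =>
      rw [prevD_eq _ (show (ComplexShape.up ℕ).Rel k (k + 1) from rfl),
        dNext_eq _ (show (ComplexShape.up ℕ).Rel (k + 1) (k + 1 + 1) from rfl),
        show (CochainComplex.of X d sq).d k (k + 1) = d k from CochainComplex.of_d X d k,
        show (CochainComplex.of X d sq).d (k + 1) (k + 1 + 1) = d (k + 1) from
          CochainComplex.of_d X d (k + 1)]
      simpa [add_comm] using (hS k).symm

/-- A complex with a contracting homotopy is homotopy equivalent to zero. -/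
def homotopyEquivZero {V : Type*} [Category V] [Preadditive V] [Limits.HasZeroObject V]
    {C : CochainComplex V ℕ} (h : Homotopy (𝟙 C) 0) :
    HomotopyEquiv C (HomologicalComplex.zero : CochainComplex V ℕ) where
  hom := 0
  inv := 0
  homotopyHomInvId := (Homotopy.ofEq (by simp)).trans h.symm
  homotopyInvHomId := Homotopy.ofEq (HomologicalComplex.isZero_zero.eq_of_src _ _)

end

theorem mainTheorem4 {E : Type u} [NormedAddCommGroup E] [InnerProductSpace ℝ E] {n : ℕ}
    (K : BoundedGeometryComplex E n) (π : ExponentSequence n) (hπ : Antitone π.val) :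
    ∃ hd : KerIsSubcomplex K π,
      Nonempty (Homotopy (𝟙 (kerComplex K π hd)) 0) ∧
        Nonempty (HomotopyEquiv (kerComplex K π hd) zeroComplex) := by
  have hd : KerIsSubcomplex K π := K.kerIsSubcomplex π
  have h : Homotopy (𝟙 (kerComplex K π hd)) 0 :=
    contractingHomotopy _ _ (fun _ => rfl) (fun k => BoundedGeometryComplex.homotopyKer hπ k)
      (ContinuousLinearMap.ext fun z =>
        Subtype.ext (BoundedGeometryComplex.homotopySL_d_zero hπ z.2))
      (fun k => ContinuousLinearMap.ext fun z =>
        Subtype.ext (BoundedGeometryComplex.d_homotopySL_add hπ z.2))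
  exact ⟨hd, ⟨h⟩, ⟨homotopyEquivZero h⟩⟩
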